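/- Rings are associative and not necessarily unital, and ring homomorphisms need not preserve units. For a ring $R$ let $M_\infty(R)$ be the ring of infinite matrices over $R$ with finitely many nonzero entries, and for $x,y\in M_\infty(R)$ write $x\precsim_1 y$ if $x=syt$ for some $s,t\in M_\infty(R)$. Let $T(R)$ be the set of sequences $(x_n)$ in $M_\infty(R)$ with $x_n\precsim_1 x_{n+1}$ for all $n$, and let $\mathcal S(R)\subseteq T(R)$ consist of those for which, for every $n$, there is $y\in M_\infty(R)$ with $x_n=y\,x_{n+1}x_n$. For $(x_n),(y_n)\in T(R)$ write $(x_n)\precsim(y_n)$ if for every $n$ there is $m$ with $x_n\precsim_1 y_m$, and let $\sim$ be the equivalence relation associated with the preorder $\precsim$. Then $\Lambda(R)=T(R)/{\sim}$ and $\mathrm S(R)=\mathcal S(R)/{\sim}\subseteq\Lambda(R)$ are commutative monoids with the order induced by $\precsim$ and the addition $[(x_n)]+[(y_n)]=[(x_n\oplus y_n)]$, where $x\oplus y$ is the block diagonal matrix with blocks $x,y$. A ring homomorphism $\phi\colon R\to R'$ induces maps $\Lambda(\phi)\colon\Lambda(R)\to\Lambda(R')$ and $\mathrm S(\phi)\colon\mathrm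 S(R)\to\mathrm S(R')$ by $[(x_n)]\mapsto[(\phi(x_n))]$ (with $\phi$ applied entrywise). The ring $R$ is *dense* if whenever $x\precsim_1 y$ in $M_\infty(R)$ there is $z\in M_\infty(R)$ with $x\precsim_1 z\precsim_1 y$. It is *left normal* if for all $a,b,c\in M_\infty(R)$ with $a=ba$ and $b=cb$ there are $d,e\in M_\infty(R)$ with $a=da$, $d=ed$ and $e=ce$. In a partially ordered set write $x\ll y$ if, for every increasing sequence $(z_n)$ that has a supremum with $y\le\sup_n z_n$, there is $m$ with $x\le z_m$. A *$\mathrm{Cu}$-semigroup* is a commutative monoid $S$ with a partial order compatible with addition, with $0\le x$ for all $x\in S$, such that (O1) increasing sequences have suprema; (O2) every element is the supremum of a sequence $(x_n)$ with $x_n\ll x_{n+1}$ for all $n$; (O3) $x'\ll x$ and $y'\ll y$ imply $x'+y'\ll x+y$; (O4) $\sup_n(x_n+y_n)=\sup_n x_n+\sup_n y_n$ for increasing sequences $(x_n),(y_n)$. *$\mathrm{Cu}$-morphisms* are the maps preserving addition, $0$, $\le$, $\ll$ and suprema of increasing sequences. Direct limits in the resulting category $\mathrm{Cu}$ are understood in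 the sense of the universal property. **Theorem.** Let $((R_\lambda)_{\lambda\in\Omega},(\phi_{\mu,\lambda})_{\mu\ge\lambda})$ be a direct system of rings over a (nonempty) directed set $\Omega$, with direct limit $R=\varinjlim R_\lambda$ and canonical maps $\phi_\lambda\colon R_\lambda\to R$. 1. If all $R_\lambda$ are dense, then $R$ is dense, the $\Lambda(R_\lambda)$ with the maps $\Lambda(\phi_{\mu,\lambda})$ form a direct system in $\mathrm{Cu}$, and $\Lambda(R)$ with the maps $\Lambda(\phi_\lambda)$ is its direct limit in $\mathrm{Cu}$: $\Lambda(\varinjlim R_\lambda)=\varinjlim_{\mathrm{Cu}}\Lambda(R_\lambda)$. The hypothesis holds, for example, if $R_\lambda^2=R_\lambda$ for all $\lambda$ (every element is a finite sum of products). 2. If all $R_\lambda$ are left normal, then $R$ is left normal, the $\mathrm S(R_\lambda)$ with the maps $\mathrm S(\phi_{\mu,\lambda})$ form a direct system in $\mathrm{Cu}$, and $\mathrm S(R)$ with the maps $\mathrm S(\phi_\lambda)$ is its direct limit in $\mathrm{Cu}$: $\mathrm S(\varinjlim R_\lambda)=\varinjlim_{\mathrm{Cu}}\mathrm S(R_\lambda)$.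 -/

import Mathlib

universe u v w

namespace CuntzRing

/-- `M_∞(R)`: infinite matrices over `R` with only finitely many nonzero entries. -/
@[ext]
structure InfMat (R : Type*) [Zero R] where
  entry : ℕ → ℕ → R
  finite_support : {p : ℕ × ℕ | entry p.1 p.2 ≠ 0}.Finite

/-- The relation `x ≾₁ y`: one has `x = s y t` for some elements `s, t`. -/
def Below {A : Type*} [Mul A] (x y : A) : Prop := ∃ s t : A, x = s * y * t

namespace InfMat

section ZeroPart

variable {R : Type*} [Zero R]

/-- The entries of `x` outside the upper left `N × N` corner vanish. -/
def Bdd (N : ℕ) (x : InfMat R) : Prop := ∀ i j, N ≤ i ∨ N ≤ j → x.entry i j = 0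

theorem finite_of_bdd {f : ℕ → ℕ → R} (N : ℕ) (h : ∀ i j, N ≤ i ∨ N ≤ j → f i j = 0) :
    {p : ℕ × ℕ | f p.1 p.2 ≠ 0}.Finite := by
  refine ((Set.finite_Iio N).prod (Set.finite_Iio N)).subset ?_
  rintro ⟨i, j⟩ hp
  simp only [Set.mem_prod, Set.mem_Iio]
  by_contra hc
  exact hp (h i j (by omega))

theorem exists_bdd (x : InfMat R) : ∃ N, Bdd N x := by
  obtain ⟨a, ha⟩ := (x.finite_support.image Prod.fst).bddAbove
  obtain ⟨b, hb⟩ := (x.finite_support.image Prod.snd).bddAbove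
  refine ⟨a + b + 1, fun i j h => ?_⟩
  by_contra hne
  have h1 : i ≤ a := ha ⟨(i, j), hne, rfl⟩
  have h2 : j ≤ b := hb ⟨(i, j), hne, rfl⟩
  omega

theorem Bdd.mono {x : InfMat R} {N M : ℕ} (h : Bdd N x) (hNM : N ≤ M) : Bdd M x :=
  fun i j hij => h i j (by omega)

/-- The least `n` such that `x` has a finite representative in `M_n(R)`. -/
noncomputable def size (x : InfMat R) : ℕ := sInf {N | Bdd N x}

theorem bdd_size (x : InfMat R) : Bdd x.size x := Nat.sInf_mem x.exists_bdd

/-- The infinite matrix represented by `diag (x, y)`, where `x` is regarded as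
an `n × n` matrix. -/
def blockSum (n : ℕ) (x y : InfMat R) : InfMat R where
  entry i j :=
    if i < n ∧ j < n then x.entry i j
    else if n ≤ i ∧ n ≤ j then y.entry (i - n) (j - n) else 0
  finite_support := by
    obtain ⟨N, hN⟩ := y.exists_bdd
    refine finite_of_bdd (f := fun i j => if i < n ∧ j < n then x.entry i j
      else if n ≤ i ∧ n ≤ j then y.entry (i - n) (j - n) else 0) (N + n) fun i j h => ?_
    split_ifs with h1 h2
    · omega
    · exact hN _ _ (by omega)
    · rfl

/-- The diagonal sum `x ⊕ y`, taken with the smallest finite representative of `x`. -/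
noncomputable def oplus (x y : InfMat R) : InfMat R := blockSum x.size x y

instance : Zero (InfMat R) := ⟨⟨fun _ _ => 0, by simp⟩⟩

@[simp] theorem zero_entry (i j : ℕ) : (0 : InfMat R).entry i j = 0 := rfl

/-- The upper left `N × N` corner. -/
def corner (N : ℕ) (x : InfMat R) : Matrix (Fin N) (Fin N) R := fun i j => x.entry i j

end ZeroPart

section RingPart

variable {R : Type*} [NonUnitalRing R]

instance : Add (InfMat R) := ⟨fun x y => ⟨fun i j => x.entry i j + y.entry i j, by
  obtain ⟨N, hN⟩ := x.exists_bdd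
  obtain ⟨M, hM⟩ := y.exists_bdd
  refine finite_of_bdd (f := fun i j => x.entry i j + y.entry i j) (N + M) fun i j h => ?_
  rw [hN i j (by omega), hM i j (by omega), add_zero]⟩⟩

instance : Neg (InfMat R) := ⟨fun x => ⟨fun i j => - x.entry i j, by
  obtain ⟨N, hN⟩ := x.exists_bdd
  exact finite_of_bdd (f := fun i j => - x.entry i j) N fun i j h => by
    rw [hN i j h, neg_zero]⟩⟩

/-- Matrix multiplication; the sum has only finitely many nonzero terms. -/
noncomputable instance : Mul (InfMat R) :=
  ⟨fun x y => ⟨fun i j => ∑ᶠ k, x.entry i k * y.entry k j, by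
    obtain ⟨N, hN⟩ := x.exists_bdd
    obtain ⟨M, hM⟩ := y.exists_bdd
    refine finite_of_bdd (f := fun i j => ∑ᶠ k, x.entry i k * y.entry k j) (N + M)
      fun i j h => ?_
    rw [← finsum_zero (M := R) (α := ℕ)]
    refine finsum_congr fun k => ?_
    rcases h with h | h
    · rw [hN i k (by omega), zero_mul]
    · rw [hM k j (by omega), mul_zero]⟩⟩

@[simp] theorem add_entry (x y : InfMat R) (i j : ℕ) :
    (x + y).entry i j = x.entry i j + y.entry i j := rfl

@[simp] theorem neg_entry (x : InfMat R) (i j : ℕ) : (-x).entry i j = - x.entry i j := rfl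

theorem mul_entry (x y : InfMat R) (i j : ℕ) :
    (x * y).entry i j = ∑ᶠ k, x.entry i k * y.entry k j := rfl

section Place

variable {ι κ o : Type} [Fintype ι] [Fintype κ] [Fintype o]

/-- The finite matrix `X`, placed into rows `e` and columns `f` of an infinite matrix. -/
def place (e : ι → ℕ) (f : κ → ℕ) (X : Matrix ι κ R) : InfMat R where
  entry i j := ∑ a, ∑ b, if e a = i ∧ f b = j then X a b else 0
  finite_support := by
    refine ((Set.finite_range e).prod (Set.finite_range f)).subset ?_
    rintro ⟨i, j⟩ hp
    by_contra hc
    refine hp (Finset.sum_eq_zero fun a _ => Finset.sum_eq_zero fun b _ => if_neg ?_)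
    rintro ⟨rfl, rfl⟩
    exact hc ⟨⟨a, rfl⟩, ⟨b, rfl⟩⟩

theorem place_entry (e : ι → ℕ) (f : κ → ℕ) (X : Matrix ι κ R) (i j : ℕ) :
    (place e f X).entry i j = ∑ a, ∑ b, if e a = i ∧ f b = j then X a b else 0 := rfl

theorem place_apply {e : ι → ℕ} {f : κ → ℕ} (he : e.Injective) (hf : f.Injective)
    (X : Matrix ι κ R) (a : ι) (b : κ) : (place e f X).entry (e a) (f b) = X a b := by
  classical
  rw [place_entry, Finset.sum_eq_single a, Finset.sum_eq_single b]
  · simp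
  · intro b' _ hb
    exact if_neg fun h => hb (hf h.2)
  · simp
  · intro a' _ ha
    exact Finset.sum_eq_zero fun b' _ => if_neg fun h => ha (he h.1)
  · simp

theorem place_of_notMem (e : ι → ℕ) (f : κ → ℕ) (X : Matrix ι κ R) {i j : ℕ}
    (h : i ∉ Set.range e ∨ j ∉ Set.range f) : (place e f X).entry i j = 0 := by
  refine Finset.sum_eq_zero fun a _ => Finset.sum_eq_zero fun b _ => if_neg ?_
  rintro ⟨rfl, rfl⟩
  simp at h

/-- Characterization of `place` for injective index maps. -/
theorem eq_place {e : ι → ℕ} {f : κ → ℕ} (he : e.Injective) (hf : f.Injective)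
    {X : Matrix ι κ R} {x : InfMat R} (h : ∀ a b, x.entry (e a) (f b) = X a b)
    (h0 : ∀ i j, i ∉ Set.range e ∨ j ∉ Set.range f → x.entry i j = 0) : x = place e f X := by
  ext i j
  by_cases hij : i ∉ Set.range e ∨ j ∉ Set.range f
  · rw [h0 i j hij, place_of_notMem e f X hij]
  · simp only [not_or, not_not] at hij
    obtain ⟨⟨a, rfl⟩, ⟨b, rfl⟩⟩ := hij
    rw [h, place_apply he hf]

theorem place_add (e : ι → ℕ) (f : κ → ℕ) (X Y : Matrix ι κ R) :
    place e f X + place e f Y = place e f (X + Y) := by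
  ext i j
  simp only [add_entry, place_entry, ← Finset.sum_add_distrib]
  refine Finset.sum_congr rfl fun a _ => Finset.sum_congr rfl fun b _ => ?_
  split_ifs <;> simp

theorem place_mul {e : ι → ℕ} {f : κ → ℕ} {g : o → ℕ} (he : e.Injective) (hf : f.Injective)
    (hg : g.Injective) (X : Matrix ι κ R) (Y : Matrix κ o R) :
    place e f X * place f g Y = place e g (X * Y) := by
  classical
  refine eq_place he hg (fun a b => ?_) (fun i j h => ?_)
  · rw [mul_entry, finsum_eq_sum_of_support_subset (s := Finset.univ.image f)]
    · rw [Finset.sum_image (fun a _ b _ h => hf h), Matrix.mul_apply]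
      exact Finset.sum_congr rfl fun c _ => by rw [place_apply he hf, place_apply hf hg]
    · intro k hk
      by_contra hc
      refine hk ?_
      dsimp only
      rw [place_of_notMem e f X (Or.inr (by simpa using hc)), zero_mul]
  · rw [mul_entry, ← finsum_zero (M := R) (α := ℕ)]
    refine finsum_congr fun k => ?_
    rcases h with h | h
    · rw [place_of_notMem e f X (Or.inl h), zero_mul]
    · rw [place_of_notMem f g Y (Or.inr h), mul_zero]

end Place

theorem eq_place_corner {N : ℕ} {x : InfMat R} (h : Bdd N x) :
    x = place (Fin.val : Fin N → ℕ) Fin.val (corner N x) := by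
  refine eq_place Fin.val_injective Fin.val_injective (fun _ _ => rfl) fun i j hij => ?_
  refine h i j ?_
  rcases hij with hi | hj
  · exact Or.inl (not_lt.1 fun hlt => hi ⟨⟨i, hlt⟩, rfl⟩)
  · exact Or.inr (not_lt.1 fun hlt => hj ⟨⟨j, hlt⟩, rfl⟩)

theorem exists_place₃ (x y z : InfMat R) : ∃ (N : ℕ) (X Y Z : Matrix (Fin N) (Fin N) R),
    x = place Fin.val Fin.val X ∧ y = place Fin.val Fin.val Y ∧ z = place Fin.val Fin.val Z := by
  obtain ⟨a, ha⟩ := x.exists_bdd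
  obtain ⟨b, hb⟩ := y.exists_bdd
  obtain ⟨c, hc⟩ := z.exists_bdd
  exact ⟨a + b + c, _, _, _, eq_place_corner (ha.mono (by omega)),
    eq_place_corner (hb.mono (by omega)), eq_place_corner (hc.mono (by omega))⟩

/-- `M_∞(R)` is a ring (without unit). -/
noncomputable instance : NonUnitalRing (InfMat R) where
  add_assoc _ _ _ := by ext; simp [add_assoc]
  zero_add _ := by ext; simp
  add_zero _ := by ext; simp
  add_comm _ _ := by ext; simp [add_comm]
  neg_add_cancel _ := by ext; simp
  nsmul := nsmulRec
  zsmul := zsmulRec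
  zero_mul x := by ext; simp [mul_entry]
  mul_zero x := by ext; simp [mul_entry]
  left_distrib x y z := by
    obtain ⟨N, X, Y, Z, rfl, rfl, rfl⟩ := exists_place₃ x y z
    have h := Fin.val_injective (n := N)
    rw [place_add, place_mul h h h, place_mul h h h, place_mul h h h, place_add, Matrix.mul_add]
  right_distrib x y z := by
    obtain ⟨N, X, Y, Z, rfl, rfl, rfl⟩ := exists_place₃ x y z
    have h := Fin.val_injective (n := N)
    rw [place_add, place_mul h h h, place_mul h h h, place_mul h h h, place_add, Matrix.add_mul]
  mul_assoc x y z := by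
    obtain ⟨N, X, Y, Z, rfl, rfl, rfl⟩ := exists_place₃ x y z
    have h := Fin.val_injective (n := N)
    rw [place_mul h h h, place_mul h h h, place_mul h h h, place_mul h h h, Matrix.mul_assoc]

/-- The homomorphism `M_∞(R) → M_∞(R')` induced by a ring homomorphism, entrywise. -/
def map {R' : Type*} [NonUnitalRing R'] (φ : R →ₙ+* R') (x : InfMat R) : InfMat R' where
  entry i j := φ (x.entry i j)
  finite_support := x.finite_support.subset fun p hp h => hp (by
    rw [h, map_zero])

theorem map_mul {R' : Type*} [NonUnitalRing R'] (φ : R →ₙ+* R') (x y : InfMat R) :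
    map φ (x * y) = map φ x * map φ y := by
  ext i j
  change φ (∑ᶠ k, x.entry i k * y.entry k j) = ∑ᶠ k, φ (x.entry i k) * φ (y.entry k j)
  obtain ⟨N, hN⟩ := x.exists_bdd
  have key : (Function.support fun k => x.entry i k * y.entry k j) ⊆ Finset.range N := by
    intro k hk
    by_contra hc
    refine hk ?_
    dsimp only
    rw [hN i k (Or.inr (by simpa using hc)), zero_mul]
  rw [finsum_eq_sum_of_support_subset _ key, map_sum,
    finsum_eq_sum_of_support_subset (s := Finset.range N)]
  · exact Finset.sum_congr rfl fun k _ => _root_.map_mul φ _ _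
  · intro k hk
    refine key fun h => hk ?_
    dsimp only at h ⊢
    rw [← _root_.map_mul, h, map_zero]

theorem map_below {R' : Type*} [NonUnitalRing R'] (φ : R →ₙ+* R') {x y : InfMat R}
    (h : Below x y) : Below (map φ x) (map φ y) := by
  obtain ⟨s, t, rfl⟩ := h
  exact ⟨map φ s, map φ t, by rw [map_mul, map_mul]⟩

end RingPart

end InfMat

open InfMat

theorem Below.trans {A : Type*} [Semigroup A] {x y z : A} (h : Below x y) (h' : Below y z) :
    Below x z := by
  obtain ⟨s, t, rfl⟩ := h
  obtain ⟨s', t', rfl⟩ := h'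
  exact ⟨s * s', t' * t, by simp only [mul_assoc]⟩

/-- A ring `R` is dense if the relation `≾₁` on `M_∞(R)` is dense. -/
def IsDenseRing (R : Type*) [NonUnitalRing R] : Prop :=
  ∀ x y : InfMat R, Below x y → ∃ z : InfMat R, Below x z ∧ Below z y

def IsLeftNormalRing (R : Type*) [NonUnitalRing R] : Prop :=
  ∀ a b c : InfMat R, a = b * a → b = c * b →
    ∃ d e : InfMat R, a = d * a ∧ d = e * d ∧ e = c * e

/-- `R² = R`: every element is a finite sum of products. -/
def IsIdempotentRing (R : Type*) [NonUnitalRing R] : Prop :=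
  AddSubgroup.closure {x : R | ∃ a b : R, x = a * b} = ⊤

section FiniteMatrices

variable {R : Type*} [NonUnitalRing R]

/-- The relation `≾₁` for finite square matrices of possibly different sizes. -/
def FinBelow {ι κ : Type} [Fintype ι] [Fintype κ] (X : Matrix ι ι R) (Y : Matrix κ κ R) : Prop :=
  ∃ (S : Matrix ι κ R) (T : Matrix κ ι R), X = S * Y * T

variable {ι κ o : Type} [Fintype ι] [Fintype κ] [Fintype o]

theorem FinBelow.below_place {X : Matrix ι ι R} {Y : Matrix κ κ R} (h : FinBelow X Y)
    {e : ι → ℕ} {f : κ → ℕ} (he : e.Injective) (hf : f.Injective) :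
    Below (place e e X) (place f f Y) := by
  obtain ⟨S, T, rfl⟩ := h
  exact ⟨place e f S, place f e T, by rw [place_mul he hf hf, place_mul he hf he]⟩

theorem FinBelow.of_place {X : Matrix ι ι R} {Y : Matrix κ κ R}
    {e : ι → ℕ} {f : κ → ℕ} (he : e.Injective) (hf : f.Injective)
    (h : Below (place e e X) (place f f Y)) : FinBelow X Y := by
  classical
  obtain ⟨s, t, hst⟩ := h
  refine ⟨Matrix.of fun a b => s.entry (e a) (f b), Matrix.of fun b a => t.entry (f b) (e a), ?_⟩
  have key (x y : InfMat R) (i j : ℕ)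
      (h0 : ∀ k, k ∉ Set.range f → x.entry i k * y.entry k j = 0) :
      (x * y).entry i j = ∑ c, x.entry i (f c) * y.entry (f c) j := by
    rw [mul_entry, finsum_eq_sum_of_support_subset (s := Finset.univ.image f),
      Finset.sum_image (fun a _ b _ h => hf h)]
    intro k hk
    by_contra hc
    exact hk (h0 k (by simpa using hc))
  ext a b
  rw [← place_apply he he X a b, hst, key, Matrix.mul_apply]
  · refine Finset.sum_congr rfl fun c _ => ?_
    rw [key, Matrix.mul_apply]
    · congr 1
      exact Finset.sum_congr rfl fun d _ => by rw [place_apply hf hf, Matrix.of_apply]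
    · intro k hk
      rw [place_of_notMem f f Y (Or.inl hk), mul_zero]
  · intro k hk
    have : (s * place f f Y).entry (e a) k = 0 := by
      rw [mul_entry, ← finsum_zero (M := R) (α := ℕ)]
      exact finsum_congr fun l => by rw [place_of_notMem f f Y (Or.inr hk), mul_zero]
    rw [this, zero_mul]

theorem FinBelow.trans {X : Matrix ι ι R} {Y : Matrix κ κ R} {Z : Matrix o o R}
    (h : FinBelow X Y) (h' : FinBelow Y Z) : FinBelow X Z := by
  obtain ⟨S, T, rfl⟩ := h
  obtain ⟨S', T', rfl⟩ := h'
  exact ⟨S * S', T' * T, by simp only [Matrix.mul_assoc]⟩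

/-- The finite matrix `diag (X, Y)`. -/
abbrev diag₂ (X : Matrix ι ι R) (Y : Matrix κ κ R) : Matrix (ι ⊕ κ) (ι ⊕ κ) R :=
  Matrix.fromBlocks X 0 0 Y

variable {ι' κ' : Type} [Fintype ι'] [Fintype κ']

theorem FinBelow.diag {X : Matrix ι ι R} {Y : Matrix κ κ R} {X' : Matrix ι' ι' R}
    {Y' : Matrix κ' κ' R} (h : FinBelow X X') (h' : FinBelow Y Y') :
    FinBelow (diag₂ X Y) (diag₂ X' Y') := by
  obtain ⟨S, T, rfl⟩ := h
  obtain ⟨S', T', rfl⟩ := h'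
  exact ⟨Matrix.fromBlocks S 0 0 S', Matrix.fromBlocks T 0 0 T', by
    simp [diag₂, Matrix.fromBlocks_multiply]⟩

theorem FinBelow.reindex {X : Matrix ι ι R} {Y : Matrix κ κ R} (h : FinBelow X Y)
    (σ : ι' ≃ ι) (τ : κ' ≃ κ) : FinBelow (X.submatrix σ σ) (Y.submatrix τ τ) := by
  obtain ⟨S, T, rfl⟩ := h
  exact ⟨S.submatrix σ τ, T.submatrix τ σ, by simp [Matrix.submatrix_mul_equiv]⟩

/-- `X` is a finite matrix from which `x` arises by placing its entries suitably. -/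
def Rep (x : InfMat R) (X : Matrix ι ι R) : Prop :=
  ∃ e : ι → ℕ, e.Injective ∧ x = place e e X

theorem Rep.below_iff {x y : InfMat R} {X : Matrix ι ι R} {Y : Matrix κ κ R}
    (hx : Rep x X) (hy : Rep y Y) : Below x y ↔ FinBelow X Y := by
  obtain ⟨e, he, rfl⟩ := hx
  obtain ⟨f, hf, rfl⟩ := hy
  exact ⟨FinBelow.of_place he hf, fun h => h.below_place he hf⟩

theorem FinBelow.congr_rep {x : InfMat R} {X : Matrix ι ι R} {Y : Matrix κ κ R}
    {Z : Matrix o o R} (h : FinBelow Z X) (hX : Rep x X) (hY : Rep x Y) : FinBelow Z Y := by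
  have hZ : Rep (place (fun a => (Fintype.equivFin o a : ℕ)) _ Z) Z :=
    ⟨_, fun a b hab => (Fintype.equivFin o).injective (Fin.ext hab), rfl⟩
  exact (hZ.below_iff hY).1 ((hZ.below_iff hX).2 h)

theorem rep_corner {N : ℕ} {x : InfMat R} (h : Bdd N x) : Rep x (corner N x) :=
  ⟨Fin.val, Fin.val_injective, eq_place_corner h⟩

theorem rep_blockSum {n m : ℕ} {x y : InfMat R} (hy : Bdd m y) :
    Rep (blockSum n x y) (diag₂ (corner n x) (corner m y)) := by
  have he : Function.Injective (Sum.elim Fin.val (fun b => n + b.val) : Fin n ⊕ Fin m → ℕ) := by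
    rintro (a | a) (b | b) h <;> simp only [Sum.elim_inl, Sum.elim_inr] at h
    · exact congrArg _ (Fin.ext h)
    · omega
    · omega
    · exact congrArg _ (Fin.ext (by omega))
  refine ⟨_, he, eq_place he he ?_ ?_⟩
  · rintro (a | a) (b | b) <;> simp [blockSum, corner]
  · intro i j h
    simp only [blockSum]
    split_ifs with h1 h2
    · rcases h with h | h
      · exact absurd ⟨Sum.inl ⟨i, h1.1⟩, rfl⟩ h
      · exact absurd ⟨Sum.inl ⟨j, h1.2⟩, rfl⟩ h
    · refine hy _ _ ?_
      rcases h with h | h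
      · refine Or.inl (not_lt.1 fun hlt => h ⟨Sum.inr ⟨i - n, hlt⟩, ?_⟩)
        simp only [Sum.elim_inr]; omega
      · refine Or.inr (not_lt.1 fun hlt => h ⟨Sum.inr ⟨j - n, hlt⟩, ?_⟩)
        simp only [Sum.elim_inr]; omega
    · rfl

theorem exists_rep_oplus (x y : InfMat R) :
    ∃ (n m : ℕ) (X : Matrix (Fin n) (Fin n) R) (Y : Matrix (Fin m) (Fin m) R),
      Rep x X ∧ Rep y Y ∧ Rep (oplus x y) (diag₂ X Y) :=
  ⟨_, _, _, _, rep_corner x.bdd_size, rep_corner y.bdd_size, rep_blockSum y.bdd_size⟩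

theorem oplus_below {x y x' y' : InfMat R} (h : Below x x') (h' : Below y y') :
    Below (oplus x y) (oplus x' y') := by
  obtain ⟨_, _, X, Y, hX, hY, hXY⟩ := exists_rep_oplus x y
  obtain ⟨_, _, X', Y', hX', hY', hXY'⟩ := exists_rep_oplus x' y'
  exact (hXY.below_iff hXY').2 (((hX.below_iff hX').1 h).diag ((hY.below_iff hY').1 h'))

theorem oplus_comm_below {x y x' y' : InfMat R} (h : Below x x') (h' : Below y y') :
    Below (oplus x y) (oplus y' x') := by
  obtain ⟨_, _, X, Y, hX, hY, hXY⟩ := exists_rep_oplus x y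
  obtain ⟨_, _, Y', X', hY', hX', hXY'⟩ := exists_rep_oplus y' x'
  refine (hXY.below_iff hXY').2 ?_
  have := (((hX.below_iff hX').1 h).diag ((hY.below_iff hY').1 h')).reindex
    (Equiv.refl _) (Equiv.sumComm _ _)
  simpa [diag₂, Matrix.fromBlocks_submatrix_sum_swap_sum_swap] using this

theorem oplus_assoc_below {x y z x' y' z' x'' y'' z'' : InfMat R} (hx : Below x x')
    (hy : Below y y') (hz : Below z z') (hx' : Below x' x'') (hy' : Below y' y'')
    (hz' : Below z' z'') :
    Below (oplus (oplus x y) z) (oplus x'' (oplus y'' z'')) := by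
  obtain ⟨_, _, W, Z, hW, hZ, hWZ⟩ := exists_rep_oplus (oplus x y) z
  obtain ⟨_, _, X'', V, hX'', hV, hXV⟩ := exists_rep_oplus x'' (oplus y'' z'')
  obtain ⟨_, _, X', Y', hX', hY', hXY'⟩ := exists_rep_oplus x' y'
  obtain ⟨_, _, Y₁, Z₁, hY₁, hZ₁, hYZ₁⟩ := exists_rep_oplus y'' z''
  obtain ⟨N, hN⟩ := z'.exists_bdd
  have hZ' := rep_corner hN
  have h₁ : FinBelow W (diag₂ X' Y') := (hW.below_iff hXY').1 (oplus_below hx hy)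
  have h₂ := h₁.diag ((hZ.below_iff hZ').1 hz)
  have h₃ : FinBelow (diag₂ W Z) (diag₂ X' (diag₂ Y' (corner N z'))) := by
    have h := h₂.reindex (Equiv.refl _) (Equiv.sumAssoc _ _ _).symm
    have e : (diag₂ (diag₂ X' Y') (corner N z')).submatrix (Equiv.sumAssoc _ _ _).symm
        (Equiv.sumAssoc _ _ _).symm = diag₂ X' (diag₂ Y' (corner N z')) := by
      ext (i | i | i) (j | j | j) <;> rfl
    rw [e] at h
    simpa using h
  have h₄ : FinBelow (diag₂ Y' (corner N z')) V :=
    (((hY'.below_iff hY₁).1 hy').diag ((hZ'.below_iff hZ₁).1 hz')).congr_rep hYZ₁ hV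
  exact (hWZ.below_iff hXV).2 (h₃.trans (((hX'.below_iff hX'').1 hx').diag h₄))

theorem zero_oplus (x : InfMat R) : oplus 0 x = x := by
  have h0 : (0 : InfMat R).size = 0 := Nat.sInf_eq_zero.2 (Or.inl fun _ _ _ => rfl)
  ext i j
  simp [oplus, blockSum, h0]

/-- The diagonal sum with the rows and columns of `x` and `y` interleaved. Unlike `⊕` it is
multiplicative; it is used only to show that `S(R)` is closed under addition. -/
def interleave (x y : InfMat R) : InfMat R where
  entry i j :=
    if i % 2 = 0 ∧ j % 2 = 0 then x.entry (i / 2) (j / 2)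
    else if i % 2 = 1 ∧ j % 2 = 1 then y.entry (i / 2) (j / 2) else 0
  finite_support := by
    obtain ⟨N, hN⟩ := x.exists_bdd
    obtain ⟨M, hM⟩ := y.exists_bdd
    refine finite_of_bdd (f := fun i j => if i % 2 = 0 ∧ j % 2 = 0 then x.entry (i / 2) (j / 2)
      else if i % 2 = 1 ∧ j % 2 = 1 then y.entry (i / 2) (j / 2) else 0) (2 * (N + M))
      fun i j h => ?_
    split_ifs with h1 h2
    · exact hN _ _ (by omega)
    · exact hM _ _ (by omega)
    · rfl

/-- The positions used by `interleave`. -/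
def interleaveIdx (N : ℕ) : Fin N ⊕ Fin N → ℕ :=
  Sum.elim (fun a => 2 * a.val) (fun a => 2 * a.val + 1)

theorem interleaveIdx_injective (N : ℕ) : (interleaveIdx N).Injective := by
  rintro (a | a) (b | b) h <;> simp only [interleaveIdx, Sum.elim_inl, Sum.elim_inr] at h
  · exact congrArg _ (Fin.ext (by omega))
  · omega
  · omega
  · exact congrArg _ (Fin.ext (by omega))

theorem interleave_eq_place {N : ℕ} {x y : InfMat R} (hx : Bdd N x) (hy : Bdd N y) :
    interleave x y =
      place (interleaveIdx N) (interleaveIdx N) (diag₂ (corner N x) (corner N y)) := by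
  have he := interleaveIdx_injective N
  have hl (i : ℕ) (h : i % 2 = 0) (hi : i ∉ Set.range (interleaveIdx N)) : N ≤ i / 2 :=
    not_lt.1 fun hlt => hi ⟨Sum.inl ⟨i / 2, hlt⟩, by
      simp only [interleaveIdx, Sum.elim_inl]; omega⟩
  have hr (i : ℕ) (h : i % 2 = 1) (hi : i ∉ Set.range (interleaveIdx N)) : N ≤ i / 2 :=
    not_lt.1 fun hlt => hi ⟨Sum.inr ⟨i / 2, hlt⟩, by
      simp only [interleaveIdx, Sum.elim_inr]; omega⟩
  refine eq_place he he ?_ ?_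
  · have h2 (n : ℕ) : (2 * n + 1) / 2 = n := by omega
    rintro (a | a) (b | b) <;> simp [interleave, interleaveIdx, corner, h2, Nat.add_mod]
  · intro i j h
    simp only [interleave]
    split_ifs with h1 h2
    · exact hx _ _ (h.imp (hl i h1.1) (hl j h1.2))
    · exact hy _ _ (h.imp (hr i h2.1) (hr j h2.2))
    · rfl

theorem interleave_mul (x y x' y' : InfMat R) :
    interleave x y * interleave x' y' = interleave (x * x') (y * y') := by
  obtain ⟨a, ha⟩ := x.exists_bdd
  obtain ⟨b, hb⟩ := y.exists_bdd
  obtain ⟨c, hc⟩ := x'.exists_bdd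
  obtain ⟨d, hd⟩ := y'.exists_bdd
  obtain ⟨f, hf⟩ := (x * x').exists_bdd
  obtain ⟨g, hg⟩ := (y * y').exists_bdd
  have key {N : ℕ} {u v : InfMat R} (hu : Bdd N u) (hv : Bdd N v) (huv : Bdd N (u * v)) :
      corner N u * corner N v = corner N (u * v) := by
    have h := Fin.val_injective (n := N)
    have h1 : place Fin.val Fin.val (corner N u * corner N v) =
        place Fin.val Fin.val (corner N (u * v)) := by
      rw [← place_mul h h h, ← eq_place_corner hu, ← eq_place_corner hv, ← eq_place_corner huv]
    ext i j
    rw [← place_apply h h (corner N u * corner N v), h1, place_apply h h]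
  have he := interleaveIdx_injective (a + b + c + d + f + g)
  rw [interleave_eq_place (ha.mono (M := a + b + c + d + f + g) (by omega)) (hb.mono (by omega)),
    interleave_eq_place (hc.mono (M := a + b + c + d + f + g) (by omega)) (hd.mono (by omega)),
    interleave_eq_place (hf.mono (M := a + b + c + d + f + g) (by omega)) (hg.mono (by omega)),
    place_mul he he he, ← key (ha.mono (by omega)) (hc.mono (by omega)) (hf.mono (by omega)),
    ← key (hb.mono (by omega)) (hd.mono (by omega)) (hg.mono (by omega))]
  simp [diag₂, Matrix.fromBlocks_multiply]

theorem exists_rep_interleave (x y : InfMat R) :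
    ∃ (n : ℕ) (X : Matrix (Fin n) (Fin n) R) (Y : Matrix (Fin n) (Fin n) R),
      Rep x X ∧ Rep y Y ∧ Rep (interleave x y) (diag₂ X Y) := by
  obtain ⟨a, ha⟩ := x.exists_bdd
  obtain ⟨b, hb⟩ := y.exists_bdd
  have ha' := ha.mono (M := a + b) (by omega)
  have hb' := hb.mono (M := a + b) (by omega)
  exact ⟨_, _, _, rep_corner ha', rep_corner hb', _, interleaveIdx_injective _,
    interleave_eq_place ha' hb'⟩

theorem oplus_below_interleave {x y x' y' : InfMat R} (h : Below x x') (h' : Below y y') :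
    Below (oplus x y) (interleave x' y') := by
  obtain ⟨_, _, X, Y, hX, hY, hXY⟩ := exists_rep_oplus x y
  obtain ⟨_, X', Y', hX', hY', hXY'⟩ := exists_rep_interleave x' y'
  exact (hXY.below_iff hXY').2 (((hX.below_iff hX').1 h).diag ((hY.below_iff hY').1 h'))

theorem interleave_below_oplus {x y x' y' : InfMat R} (h : Below x x') (h' : Below y y') :
    Below (interleave x y) (oplus x' y') := by
  obtain ⟨_, X, Y, hX, hY, hXY⟩ := exists_rep_interleave x y
  obtain ⟨_, _, X', Y', hX', hY', hXY'⟩ := exists_rep_oplus x' y'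
  exact (hXY.below_iff hXY').2 (((hX.below_iff hX').1 h).diag ((hY.below_iff hY').1 h'))

end FiniteMatrices

/-- `T(R)`: the sequences in `M_∞(R)` that are increasing for `≾₁`. -/
def IncSeq (R : Type*) [NonUnitalRing R] : Type _ :=
  {x : ℕ → InfMat R // ∀ n, Below (x n) (x (n + 1))}

section Semigroups

variable {R : Type*} [NonUnitalRing R]

theorem IncSeq.below_of_lt (x : IncSeq R) {m n : ℕ} (h : m < n) : Below (x.1 m) (x.1 n) := by
  induction n, h using Nat.le_induction with
  | base => exact x.2 m
  | succ k _ ih => exact ih.trans (x.2 k)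

/-- `(xₙ) ≾ (yₙ)` if for every `n` there is `m` with `xₙ ≾₁ yₘ`. -/
instance : Preorder (IncSeq R) where
  le x y := ∀ n, ∃ m, Below (x.1 n) (y.1 m)
  le_refl x n := ⟨n + 1, x.2 n⟩
  le_trans _ _ _ h h' n :=
    have ⟨m, hm⟩ := h n
    have ⟨k, hk⟩ := h' m
    ⟨k, hm.trans hk⟩

theorem IncSeq.le_def {x y : IncSeq R} : x ≤ y ↔ ∀ n, ∃ m, Below (x.1 n) (y.1 m) := Iff.rfl

/-- The sequence of componentwise diagonal sums. -/
noncomputable def IncSeq.oplus (x y : IncSeq R) : IncSeq R :=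
  ⟨fun n => (x.1 n).oplus (y.1 n), fun n => oplus_below (x.2 n) (y.2 n)⟩

theorem IncSeq.oplus_le_oplus {x y x' y' : IncSeq R} (h : x ≤ x') (h' : y ≤ y') :
    x.oplus y ≤ x'.oplus y' := by
  intro n
  obtain ⟨m, hm⟩ := h n
  obtain ⟨k, hk⟩ := h' n
  exact ⟨m + k + 1, oplus_below (hm.trans (x'.below_of_lt (by omega)))
    (hk.trans (y'.below_of_lt (by omega)))⟩

theorem IncSeq.oplus_comm_le (x y : IncSeq R) : x.oplus y ≤ y.oplus x :=
  fun n => ⟨n + 1, oplus_comm_below (x.2 n) (y.2 n)⟩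

theorem IncSeq.oplus_assoc_le (x y z : IncSeq R) :
    (x.oplus y).oplus z ≤ x.oplus (y.oplus z) :=
  fun n => ⟨n + 2, oplus_assoc_below (x.2 n) (y.2 n) (z.2 n) (x.2 (n + 1)) (y.2 (n + 1))
    (z.2 (n + 1))⟩

instance : Zero (IncSeq R) := ⟨⟨fun _ => 0, fun _ => ⟨0, 0, by simp⟩⟩⟩

theorem IncSeq.zero_oplus (x : IncSeq R) : (0 : IncSeq R).oplus x = x :=
  Subtype.ext (funext fun n => CuntzRing.zero_oplus (x.1 n))

end Semigroups

/-- `Λ(R) = T(R)/∼`, where `∼` is the antisymmetrization of `≾`. -/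
def Lam (R : Type*) [NonUnitalRing R] : Type _ := Antisymmetrization (IncSeq R) (· ≤ ·)

namespace Lam

variable {R : Type*} [NonUnitalRing R]

/-- The class `[(xₙ)]`. -/
def mk (x : IncSeq R) : Lam R := toAntisymmetrization (· ≤ ·) x

theorem ind {p : Lam R → Prop} (h : ∀ x, p (mk x)) (a : Lam R) : p a := Quotient.inductionOn' a h

noncomputable instance : PartialOrder (Lam R) :=
  inferInstanceAs (PartialOrder (Antisymmetrization (IncSeq R) (· ≤ ·)))

theorem mk_le_mk {x y : IncSeq R} : mk x ≤ mk y ↔ x ≤ y := Iff.rfl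

theorem mk_eq_of_le {x y : IncSeq R} (h : x ≤ y) (h' : y ≤ x) : mk x = mk y :=
  le_antisymm (mk_le_mk.2 h) (mk_le_mk.2 h')

noncomputable instance : Add (Lam R) :=
  ⟨Quotient.map₂ IncSeq.oplus fun _ _ h _ _ h' =>
    ⟨IncSeq.oplus_le_oplus h.1 h'.1, IncSeq.oplus_le_oplus h.2 h'.2⟩⟩

instance : Zero (Lam R) := ⟨mk 0⟩

theorem mk_add_mk (x y : IncSeq R) : mk x + mk y = mk (x.oplus y) := rfl

theorem zero_def : (0 : Lam R) = mk 0 := rfl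

protected theorem add_comm' (a b : Lam R) : a + b = b + a := by
  induction a using ind
  induction b using ind
  exact mk_eq_of_le (IncSeq.oplus_comm_le _ _) (IncSeq.oplus_comm_le _ _)

protected theorem add_assoc_le (a b c : Lam R) : a + b + c ≤ a + (b + c) := by
  induction a using ind
  induction b using ind
  induction c using ind
  exact IncSeq.oplus_assoc_le _ _ _

protected theorem zero_add' (a : Lam R) : 0 + a = a := by
  induction a using ind
  exact congrArg mk (IncSeq.zero_oplus _)

noncomputable instance : AddCommMonoid (Lam R) where
  add_assoc a b c := by
    refine le_antisymm (Lam.add_assoc_le a b c) ?_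
    have h := Lam.add_assoc_le c b a
    rwa [Lam.add_comm' (c + b) a, Lam.add_comm' c b, Lam.add_comm' b a,
      Lam.add_comm' c (a + b)] at h
  zero_add := Lam.zero_add'
  add_zero a := by rw [Lam.add_comm', Lam.zero_add']
  add_comm := Lam.add_comm'
  nsmul := nsmulRec

/-- The map `Λ(φ) : Λ(R) → Λ(R')`, `[(xₙ)] ↦ [(φ(xₙ))]`. -/
def map {R' : Type*} [NonUnitalRing R'] (φ : R →ₙ+* R') : Lam R → Lam R' :=
  Quotient.map (fun x : IncSeq R =>
      (⟨fun n => InfMat.map φ (x.1 n), fun n => map_below φ (x.2 n)⟩ : IncSeq R'))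
    fun _ _ h => ⟨fun n => (h.1 n).imp fun _ => map_below φ, fun n => (h.2 n).imp fun _ => map_below φ⟩

end Lam

/-- The set `𝒮(R) ⊆ T(R)`: for every `n` there is `y` with `xₙ = y xₙ₊₁ xₙ`. -/
def IsS {R : Type*} [NonUnitalRing R] (x : IncSeq R) : Prop :=
  ∀ n, ∃ y : InfMat R, x.1 n = y * x.1 (n + 1) * x.1 n

/-- `S(R) = 𝒮(R)/∼`, viewed inside `Λ(R)`, with the order and addition of `Λ(R)`. -/
noncomputable def SSub (R : Type*) [NonUnitalRing R] : AddSubmonoid (Lam R) where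
  carrier := {a | ∃ x : IncSeq R, IsS x ∧ Lam.mk x = a}
  zero_mem' := ⟨0, fun _ => ⟨0, by simp; rfl⟩, rfl⟩
  add_mem' := by
    rintro _ _ ⟨x, hx, rfl⟩ ⟨y, hy, rfl⟩
    refine ⟨⟨fun n => interleave (x.1 n) (y.1 n), fun n => ?_⟩, fun n => ?_,
      Lam.mk_eq_of_le (fun n => ⟨n + 1, interleave_below_oplus (x.2 n) (y.2 n)⟩)
        (fun n => ⟨n + 1, oplus_below_interleave (x.2 n) (y.2 n)⟩)⟩
    · obtain ⟨s, t, h⟩ := x.2 n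
      obtain ⟨s', t', h'⟩ := y.2 n
      exact ⟨interleave s s', interleave t t', by rw [interleave_mul, interleave_mul, ← h, ← h']⟩
    · obtain ⟨s, h⟩ := hx n
      obtain ⟨s', h'⟩ := hy n
      exact ⟨interleave s s', by simp only; rw [interleave_mul, interleave_mul, ← h, ← h']⟩

/-- The map `S(φ) : S(R) → S(R')` induced by a ring homomorphism. -/
def SSub.map {R R' : Type*} [NonUnitalRing R] [NonUnitalRing R'] (φ : R →ₙ+* R')
    (a : SSub R) : SSub R' :=
  ⟨Lam.map φ a.1, by
    obtain ⟨_, x, hx, rfl⟩ := a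
    refine ⟨_, fun n => ?_, rfl⟩
    obtain ⟨y, hy⟩ := hx n
    exact ⟨InfMat.map φ y, by
      simp only
      rw [← InfMat.map_mul, ← InfMat.map_mul, ← hy]⟩⟩

section CuCategory

/-- The (sequential) compact containment relation `x ≪ y`. -/
def WayBelow {S : Type*} [PartialOrder S] (x y : S) : Prop :=
  ∀ z : ℕ → S, Monotone z → ∀ s, IsLUB (Set.range z) s → y ≤ s → ∃ m, x ≤ z m

/-- Abstract `Cu`-semigroups: positively ordered (commutative) monoids satisfying (O1)-(O4). -/
structure IsCuSemigroup (S : Type*) [AddCommMonoid S] [PartialOrder S] : Prop where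
  add_le_add : ∀ a b c d : S, a ≤ b → c ≤ d → a + c ≤ b + d
  zero_le : ∀ a : S, 0 ≤ a
  exists_sup : ∀ x : ℕ → S, Monotone x → ∃ s, IsLUB (Set.range x) s
  exists_rapid : ∀ a : S, ∃ x : ℕ → S,
    (∀ n, WayBelow (x n) (x (n + 1))) ∧ IsLUB (Set.range x) a
  wayBelow_add : ∀ a' a b' b : S, WayBelow a' a → WayBelow b' b → WayBelow (a' + b') (a + b)
  sup_add : ∀ (x y : ℕ → S) (s t : S), Monotone x → Monotone y →
    IsLUB (Set.range x) s → IsLUB (Set.range y) t → IsLUB (Set.range fun n => x n + y n) (s + t)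

/-- `Cu`-morphisms. -/
structure IsCuHom {S T : Type*} [AddCommMonoid S] [PartialOrder S] [AddCommMonoid T]
    [PartialOrder T] (f : S → T) : Prop where
  map_zero : f 0 = 0
  map_add : ∀ a b, f (a + b) = f a + f b
  monotone : Monotone f
  map_wayBelow : ∀ a b, WayBelow a b → WayBelow (f a) (f b)
  map_sup : ∀ (x : ℕ → S) (s : S), Monotone x → IsLUB (Set.range x) s →
    IsLUB (Set.range fun n => f (x n)) (f s)

variable {Ω : Type*} [Preorder Ω] (S : Ω → Type*) [∀ i, AddCommMonoid (S i)]
  [∀ i, PartialOrder (S i)] (f : ∀ i j, i ≤ j → S i → S j)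

/-- Direct systems in the category `Cu`. -/
structure IsCuDirectSystem : Prop where
  isCu : ∀ i, IsCuSemigroup (S i)
  isCuHom : ∀ i j (h : i ≤ j), IsCuHom (f i j h)
  map_id : ∀ i a, f i i le_rfl a = a
  map_comp : ∀ i j k (hij : i ≤ j) (hjk : j ≤ k) a, f j k hjk (f i j hij a) = f i k (hij.trans hjk) a

/-- `L` with the maps `g i : S i → L` is the direct limit (colimit) of the system `(S, f)` in the
category `Cu`; the universal property is tested on `Cu`-semigroups in an arbitrary
universe. -/
structure IsCuLimit.{w', v', x', y'} {Ω : Type v'} [Preorder Ω] (S : Ω → Type x')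
    [∀ i, AddCommMonoid (S i)] [∀ i, PartialOrder (S i)] (f : ∀ i j, i ≤ j → S i → S j)
    (L : Type y') [AddCommMonoid L] [PartialOrder L] (g : ∀ i, S i → L) :
    Prop where
  isCu : IsCuSemigroup L
  isCuHom : ∀ i, IsCuHom (g i)
  compat : ∀ i j (h : i ≤ j) a, g j (f i j h a) = g i a
  universal : ∀ (T : Type w') [AddCommMonoid T] [PartialOrder T], IsCuSemigroup T →
    ∀ t : ∀ i, S i → T, (∀ i, IsCuHom (t i)) → (∀ i j (h : i ≤ j) a, t j (f i j h a) = t i a) →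
      ∃! u : L → T, IsCuHom u ∧ ∀ i a, u (g i a) = t i a

end CuCategory

end CuntzRing

namespace CuntzRing

/-! ### Recognizing direct limits in the category `Cu` -/

section CuLimit

/-! Both parts are instances of one statement about classes of `r`-increasing sequences, where `r`
is a transitive relation that need not be reflexive. Suprema of such classes are diagonal sequences
(`IsSeqModel.exists_diagonal`). If every chain of two steps can be refined (`Interpolates`), then
`WayBelow (mk x) (mk y)` says that all terms of `x` lie below one fixed term of `y`
(`IsSeqModel.wayBelow_iff`), and the axioms of a `Cu`-semigroup follow.

This turns statements about whole sequences into statements about single relations `r a b`. A matrix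
has finitely many nonzero entries, so matrices over the limit ring, and equations between them,
already occur at some stage; hence so does each single relation. This gives the two approximation
properties in `IsCuLimitCocone`: inequalities in the limit hold at a finite stage up to `≪`, and
elements from finite stages are dense for `≪`. They imply the universal property, the induced map
sending `x` to the supremum of the values `t i s` with `g i s ≪ x`
(`IsCuLimitCocone.existsUnique_desc`).

For `Λ(R)` the relation is `≾₁`, and density of the ring gives interpolation. For `S(R)` it is
`LeftBelow`, `x = u y v x`. Its increasing sequences have the same classes as the sequences in
`𝒮(R)`, and left normality gives interpolation (`IsLeftNormalRing.interpolates`). -/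

theorem WayBelow.le {S : Type*} [PartialOrder S] {x y : S} (h : WayBelow x y) : x ≤ y := by
  obtain ⟨_, hm⟩ := h (fun _ => y) monotone_const y (by simp) le_rfl
  exact hm

theorem WayBelow.trans_le {S : Type*} [PartialOrder S] {x y z : S} (h : WayBelow x y)
    (h' : y ≤ z) : WayBelow x z := fun a ha s hs hz => h a ha s hs (h'.trans hz)

theorem WayBelow.of_le {S : Type*} [PartialOrder S] {x y z : S} (h : x ≤ y)
    (h' : WayBelow y z) : WayBelow x z := fun a ha s hs hz =>
  (h' a ha s hs hz).imp fun _ hm => h.trans hm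

/-- The conditions identifying a cocone as a direct limit in the category `Cu`. -/
structure IsCuLimitCocone {Ω : Type*} [Preorder Ω] (S : Ω → Type*)
    [∀ i, AddCommMonoid (S i)] [∀ i, PartialOrder (S i)] (f : ∀ i j, i ≤ j → S i → S j)
    (L : Type*) [AddCommMonoid L] [PartialOrder L] (g : ∀ i, S i → L) : Prop where
  system : IsCuDirectSystem S f
  isCu : IsCuSemigroup L
  isCuHom : ∀ i, IsCuHom (g i)
  compat : ∀ i j (h : i ≤ j) a, g j (f i j h a) = g i a
  eventually_le : ∀ i (x' x y : S i), WayBelow x' x → g i x ≤ g i y →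
    ∃ (j : Ω) (h : i ≤ j), f i j h x' ≤ f i j h y
  exists_between : ∀ x' x : L, WayBelow x' x →
    ∃ (i : Ω) (y : S i), WayBelow x' (g i y) ∧ WayBelow (g i y) x

namespace IsCuLimitCocone

variable {Ω : Type*} [Preorder Ω] {S : Ω → Type*}
    [∀ i, AddCommMonoid (S i)] [∀ i, PartialOrder (S i)] {f : ∀ i j, i ≤ j → S i → S j}
    {L : Type*} [AddCommMonoid L] [PartialOrder L] {g : ∀ i, S i → L}
    {T : Type*} [AddCommMonoid T] [PartialOrder T] {t : ∀ i, S i → T}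

/-- Axiom (O2) in `L` gives a rapidly increasing sequence, and `exists_between` inserts a stage
element into each of its steps. -/
theorem exists_seq (H : IsCuLimitCocone S f L g) (x : L) :
    ∃ (i : ℕ → Ω) (y : ∀ n, S (i n)), (∀ n, WayBelow (g _ (y n)) (g _ (y (n + 1)))) ∧
      IsLUB (Set.range fun n => g _ (y n)) x := by
  obtain ⟨a, ha, hx⟩ := H.isCu.exists_rapid x
  choose i y h1 h2 using fun n => H.exists_between _ _ (ha n)
  refine ⟨i, y, fun n => (h2 n).trans_le (h1 (n + 1)).le, ?_, fun b hb => hx.2 ?_⟩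
  · rintro _ ⟨n, rfl⟩
    exact (h2 n).le.trans (hx.1 ⟨_, rfl⟩)
  · rintro _ ⟨n, rfl⟩
    exact (h1 n).le.trans (hb ⟨n, rfl⟩)

variable [IsDirectedOrder Ω]

/-- Any cocone respects the order of `L` on stage elements: each `s n ≪ a` falls below `b` at a
finite stage, where `t` can be applied, and `t i` preserves the supremum of the `s n`. -/
theorem le_of_le (H : IsCuLimitCocone S f L g) (ht : ∀ i, IsCuHom (t i))
    (hc : ∀ i j (h : i ≤ j) a, t j (f i j h a) = t i a) {i j : Ω} {a : S i} {b : S j}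
    (h : g i a ≤ g j b) : t i a ≤ t j b := by
  obtain ⟨k, hik, hjk⟩ := exists_ge_ge i j
  obtain ⟨s, hs, ha⟩ := (H.system.isCu i).exists_rapid a
  refine ((ht i).map_sup s a (monotone_nat_of_le_succ fun n => (hs n).le) ha).2 ?_
  rintro _ ⟨n, rfl⟩
  have h1 : WayBelow (s n) a := (hs n).trans_le (ha.1 ⟨_, rfl⟩)
  obtain ⟨l, hkl, hl⟩ := H.eventually_le k _ _ (f j k hjk b)
    ((H.system.isCuHom i k hik).map_wayBelow _ _ h1) (by rwa [H.compat, H.compat])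
  have h2 := (ht l).monotone hl
  rwa [hc, hc, hc, hc] at h2

/-- The values that the induced map has to dominate at `x`. -/
def approximants (g : ∀ i, S i → L) (t : ∀ i, S i → T) (x : L) : Set T :=
  {b | ∃ (i : Ω) (s : S i), WayBelow (g i s) x ∧ t i s = b}

/-- The value at `x` can be computed from any increasing sequence of stage elements with supremum
`x`. The sequence is not assumed rapidly increasing, so constant sequences and termwise sums are
allowed. -/
theorem isLUB_of_seq (H : IsCuLimitCocone S f L g) (ht : ∀ i, IsCuHom (t i))
    (hc : ∀ i j (h : i ≤ j) a, t j (f i j h a) = t i a) {x : L} {i : ℕ → Ω} {y : ∀ n, S (i n)}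
    (hy : Monotone fun n => g _ (y n)) (hx : IsLUB (Set.range fun n => g _ (y n)) x)
    {b : T} (hb : IsLUB (approximants g t x) b) : IsLUB (Set.range fun n => t _ (y n)) b := by
  refine ⟨?_, fun c hcb => hb.2 ?_⟩
  · rintro _ ⟨n, rfl⟩
    obtain ⟨s, hs, ha⟩ := (H.system.isCu (i n)).exists_rapid (y n)
    refine ((ht _).map_sup s _ (monotone_nat_of_le_succ fun n => (hs n).le) ha).2 ?_
    rintro _ ⟨k, rfl⟩
    have h1 : WayBelow (s k) (y n) := (hs k).trans_le (ha.1 ⟨_, rfl⟩)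
    exact hb.1 ⟨_, s k, ((H.isCuHom _).map_wayBelow _ _ h1).trans_le (hx.1 ⟨n, rfl⟩), rfl⟩
  · rintro _ ⟨j, s, hs, rfl⟩
    obtain ⟨n, hn⟩ := hs _ hy x hx le_rfl
    exact (H.le_of_le ht hc hn).trans (hcb ⟨n, rfl⟩)

theorem exists_isLUB (H : IsCuLimitCocone S f L g) (hT : IsCuSemigroup T)
    (ht : ∀ i, IsCuHom (t i)) (hc : ∀ i j (h : i ≤ j) a, t j (f i j h a) = t i a) (x : L) :
    ∃ b, IsLUB (approximants g t x) b := by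
  obtain ⟨i, y, hy, hx⟩ := H.exists_seq x
  have hm : Monotone fun n => g _ (y n) := monotone_nat_of_le_succ fun n => (hy n).le
  obtain ⟨b, hb⟩ := hT.exists_sup (fun n => t _ (y n))
    (monotone_nat_of_le_succ fun n => H.le_of_le ht hc (hy n).le)
  refine ⟨b, ?_, fun c hcb => hb.2 ?_⟩
  · rintro _ ⟨j, s, hs, rfl⟩
    obtain ⟨n, hn⟩ := hs _ hm x hx le_rfl
    exact (H.le_of_le ht hc hn).trans (hb.1 ⟨n, rfl⟩)
  · rintro _ ⟨n, rfl⟩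
    exact hcb ⟨_, y n, (hy n).trans_le (hx.1 ⟨_, rfl⟩), rfl⟩

/-- The induced map is the supremum over `approximants`. Uniqueness holds because every element of
`L` is the supremum of a sequence of stage elements, where the values are prescribed. -/
theorem existsUnique_desc [Nonempty Ω] (H : IsCuLimitCocone S f L g) (hT : IsCuSemigroup T)
    (ht : ∀ i, IsCuHom (t i)) (hc : ∀ i j (h : i ≤ j) a, t j (f i j h a) = t i a) :
    ∃! u : L → T, IsCuHom u ∧ ∀ i a, u (g i a) = t i a := by
  choose u hu using H.exists_isLUB hT ht hc
  have hmono : Monotone u := fun x y hxy => (hu x).2 <| by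
    rintro _ ⟨i, s, hs, rfl⟩
    exact (hu y).1 ⟨i, s, hs.trans_le hxy, rfl⟩
  have hug (i) (a : S i) : u (g i a) = t i a :=
    (H.isLUB_of_seq ht hc (i := fun _ => i) (y := fun _ => a) monotone_const (by simp)
      (hu _)).unique (by simp)
  refine ⟨u, ⟨⟨?_, ?_, hmono, ?_, ?_⟩, hug⟩, ?_⟩
  · obtain ⟨i⟩ := ‹Nonempty Ω›
    rw [← (H.isCuHom i).map_zero, hug, (ht i).map_zero]
  · intro a b
    obtain ⟨i, y, hy, ha⟩ := H.exists_seq a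
    obtain ⟨j, z, hz, hb⟩ := H.exists_seq b
    -- The two approximating sequences are moved to common stages `k n`, so that their termwise sum
    -- again consists of stage elements.
    choose k hik hjk using fun n => exists_ge_ge (i n) (j n)
    have hy' : Monotone fun n => g _ (y n) := monotone_nat_of_le_succ fun n => (hy n).le
    have hz' : Monotone fun n => g _ (z n) := monotone_nat_of_le_succ fun n => (hz n).le
    have e1 (n) : g (k n) (f _ _ (hik n) (y n) + f _ _ (hjk n) (z n)) = g _ (y n) + g _ (z n) := by
      rw [(H.isCuHom _).map_add, H.compat, H.compat]
    have e2 (n) : t (k n) (f _ _ (hik n) (y n) + f _ _ (hjk n) (z n)) = t _ (y n) + t _ (z n) := by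
      rw [(ht _).map_add, hc, hc]
    have h1 := H.isCu.sup_add _ _ _ _ hy' hz' ha hb
    have h2 := H.isLUB_of_seq ht hc (i := k)
      (y := fun n => f _ _ (hik n) (y n) + f _ _ (hjk n) (z n))
      (by
        intro m n hmn
        simp only [e1]
        exact H.isCu.add_le_add _ _ _ _ (hy' hmn) (hz' hmn))
      (by simpa only [e1] using h1) (hu (a + b))
    simp only [e2] at h2
    exact h2.unique (hT.sup_add _ _ _ _ (fun m n h => H.le_of_le ht hc (hy' h))
      (fun m n h => H.le_of_le ht hc (hz' h)) (H.isLUB_of_seq ht hc hy' ha (hu a))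
      (H.isLUB_of_seq ht hc hz' hb (hu b)))
  · intro a b hab
    obtain ⟨i, y, hy, hb⟩ := H.exists_seq b
    obtain ⟨n, hn⟩ := hab _ (monotone_nat_of_le_succ fun n => (hy n).le) b hb le_rfl
    -- The relation `g (y n) ≪ g (y (n + 1))` holds only in `L`. Approximating `y (n + 1)` inside
    -- its stage yields some `s k ≪ y (n + 1)` there whose image still dominates `g (y n)`; `t`
    -- preserves that relation.
    obtain ⟨s, hs, hsy⟩ := (H.system.isCu _).exists_rapid (y (n + 1))
    have hsm : Monotone s := monotone_nat_of_le_succ fun n => (hs n).le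
    obtain ⟨k, hk⟩ := hy n _ (fun _ _ h => (H.isCuHom _).monotone (hsm h)) _
      ((H.isCuHom _).map_sup _ _ hsm hsy) le_rfl
    have h1 : u a ≤ t _ (s k) := by
      rw [← hug]
      exact hmono (hn.trans hk)
    have h2 : t _ (y (n + 1)) ≤ u b := by
      rw [← hug]
      exact hmono (hb.1 ⟨_, rfl⟩)
    exact .of_le h1 (((ht _).map_wayBelow _ _ ((hs k).trans_le (hsy.1 ⟨_, rfl⟩))).trans_le h2)
  · intro x s hx hs
    refine ⟨?_, fun b hb => (hu s).2 ?_⟩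
    · rintro _ ⟨n, rfl⟩
      exact hmono (hs.1 ⟨n, rfl⟩)
    · rintro _ ⟨i, a, ha, rfl⟩
      obtain ⟨n, hn⟩ := ha x hx s hs le_rfl
      rw [← hug]
      exact (hmono hn).trans (hb ⟨n, rfl⟩)
  · rintro u' ⟨hu', hug'⟩
    funext x
    obtain ⟨i, y, hy, hx⟩ := H.exists_seq x
    have hm : Monotone fun n => g _ (y n) := monotone_nat_of_le_succ fun n => (hy n).le
    have h1 := hu'.map_sup _ _ hm hx
    simp only [hug'] at h1
    exact h1.unique (H.isLUB_of_seq ht hc hm hx (hu x))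

theorem isCuLimit [Nonempty Ω] (H : IsCuLimitCocone S f L g) : IsCuLimit.{w} S f L g where
  isCu := H.isCu
  isCuHom := H.isCuHom
  compat := H.compat
  universal _ _ _ hT _ ht hc := H.existsUnique_desc hT ht hc

end IsCuLimitCocone

end CuLimit

/-! ### Ordered monoids of increasing sequences -/

section SeqModel

/-- Sequences that are increasing for a relation `r`. -/
abbrev RSeq {A : Type*} (r : A → A → Prop) : Type _ := {x : ℕ → A // ∀ n, r (x n) (x (n + 1))}

/-- `S` is the ordered monoid of classes of `r`-increasing sequences in `A`, the addition being
induced by `op`. -/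
structure IsSeqModel {A : Type*} [Zero A] (r : A → A → Prop) (op : A → A → A)
    {S : Type*} [AddCommMonoid S] [PartialOrder S] (mk : RSeq r → S) : Prop where
  trans : ∀ {x y z}, r x y → r y z → r x z
  zero_rel : ∀ x, r 0 x
  op_rel : ∀ {x y x' y'}, r x x' → r y y' → r (op x y) (op x' y')
  surjective : mk.Surjective
  mk_le_mk : ∀ {x y}, mk x ≤ mk y ↔ ∀ n, ∃ m, r (x.1 n) (y.1 m)
  mk_zero : ∀ x : RSeq r, (∀ n, x.1 n = 0) → mk x = 0
  mk_add : ∀ x y z : RSeq r, (∀ n, z.1 n = op (x.1 n) (y.1 n)) → mk z = mk x + mk y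

/-- Every step `x ≺ y ≺ w` can be refined to steps `x ≺ p ≺ q ≺ w`. -/
def Interpolates {A : Type*} (r : A → A → Prop) : Prop :=
  ∀ x y w, r x y → r y w → ∃ p q, r x p ∧ r p q ∧ r q w

/-- Interpolation consumes a two-step chain and returns two intermediate points, so it can be
iterated: from `x ≺ p ≺ q ≺ w` one refines `p ≺ q ≺ w` and keeps the first points. The second point
is carried only to allow the next refinement. -/
theorem Interpolates.exists_rseq {A : Type*} {r : A → A → Prop} (h : Interpolates r)
    (ht : ∀ {x y z}, r x y → r y z → r x z) {x y w : A} (hx : r x y) (hy : r y w) :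
    ∃ z : RSeq r, (∀ n, r x (z.1 n)) ∧ ∀ n, r (z.1 n) w := by
  let P : Type _ := {p : A × A // r x p.1 ∧ r p.1 p.2 ∧ r p.2 w}
  have step (p : P) : ∃ q : P, r p.1.1 q.1.1 := by
    obtain ⟨p', q', h1, h2, h3⟩ := h p.1.1 p.1.2 w p.2.2.1 p.2.2.2
    exact ⟨⟨(p', q'), ht p.2.1 h1, h2, h3⟩, h1⟩
  obtain ⟨p, q, h1, h2, h3⟩ := h x y w hx hy
  choose F hF using step
  let s : ℕ → P := fun n => F^[n] ⟨(p, q), h1, h2, h3⟩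
  refine ⟨⟨fun n => (s n).1.1, fun n => ?_⟩, fun n => (s n).2.1,
    fun n => ht (s n).2.2.1 (s n).2.2.2⟩
  simp only [s, Function.iterate_succ_apply']
  exact hF _

namespace IsSeqModel

variable {A : Type*} [Zero A] {r : A → A → Prop} {op : A → A → A}
    {S : Type*} [AddCommMonoid S] [PartialOrder S] {mk : RSeq r → S}

theorem rel_of_lt (H : IsSeqModel r op mk) (x : RSeq r) {m n : ℕ} (h : m < n) :
    r (x.1 m) (x.1 n) := by
  induction n, h using Nat.le_induction with
  | base => exact x.2 m
  | succ k _ ih => exact H.trans ih (x.2 k)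

theorem rel_mono (H : IsSeqModel r op mk) {a : A} (x : RSeq r) {m n : ℕ} (ha : r a (x.1 m))
    (h : m ≤ n) : r a (x.1 n) := by
  rcases h.eq_or_lt with rfl | h
  · exact ha
  · exact H.trans ha (H.rel_of_lt x h)

/-- A diagonal sequence `(x k) (c k)` works if `c` grows fast enough that each new term dominates
the initial segments of all earlier sequences. No interpolation is needed. -/
theorem exists_diagonal (H : IsSeqModel r op mk) (x : ℕ → RSeq r)
    (hx : Monotone fun k => mk (x k)) :
    ∃ b : RSeq r, (∀ k, mk (x k) ≤ mk b) ∧ ∀ n, ∃ k l, r (b.1 n) ((x k).1 l) := by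
  have h1 (k N : ℕ) : ∃ m, ∀ i ∈ Set.Iic k, ∀ j ∈ Set.Iic N,
      r ((x i).1 j) ((x k).1 m) := by
    refine Filter.Eventually.exists (f := Filter.atTop) ?_
    rw [Filter.eventually_all_finite (Set.finite_Iic k)]
    intro i hi
    rw [Filter.eventually_all_finite (Set.finite_Iic N)]
    intro j _
    obtain ⟨m, hm⟩ := H.mk_le_mk.1 (hx hi) j
    exact Filter.eventually_atTop.2 ⟨m, fun n hn => H.rel_mono _ hm hn⟩
  choose F hF using h1
  -- The bound `c k` makes the diagonal increasing; the bound `k` makes it cofinal in every `x i`.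
  let c : ℕ → ℕ := fun k => Nat.rec 0 (fun k n => F (k + 1) (max n k)) k
  have hc (k : ℕ) : c (k + 1) = F (k + 1) (max (c k) k) := rfl
  refine ⟨⟨fun k => (x k).1 (c k), fun k => ?_⟩, fun k => H.mk_le_mk.2 fun n => ?_, fun k => ?_⟩
  · dsimp only
    rw [hc]
    exact hF (k + 1) _ k (by simp) _ (by simp)
  · refine ⟨max k n + 1, ?_⟩
    dsimp only
    rw [hc]
    exact hF _ _ k (by simp; omega) _ (by simp)
  -- The successor index is needed because `r` is not assumed reflexive.
  · exact ⟨k, c k + 1, (x k).2 _⟩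

/-- A supremum lies below the diagonal sequence, and this controls its individual terms. Statements
about suprema thereby reduce to single relations. -/
theorem isLUB_iff (H : IsSeqModel r op mk) {x : ℕ → RSeq r} (hx : Monotone fun k => mk (x k))
    {s : RSeq r} : IsLUB (Set.range fun k => mk (x k)) (mk s) ↔
      (∀ k, mk (x k) ≤ mk s) ∧ ∀ n, ∃ k l, r (s.1 n) ((x k).1 l) := by
  constructor
  · refine fun h => ⟨fun k => h.1 ⟨k, rfl⟩, fun n => ?_⟩
    obtain ⟨b, hb, hbx⟩ := H.exists_diagonal x hx
    have hsb : mk s ≤ mk b := h.2 (by rintro _ ⟨k, rfl⟩; exact hb k)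
    obtain ⟨m, hm⟩ := H.mk_le_mk.1 hsb n
    obtain ⟨k, l, hkl⟩ := hbx m
    exact ⟨k, l, H.trans hm hkl⟩
  · rintro ⟨h1, h2⟩
    refine ⟨by rintro _ ⟨k, rfl⟩; exact h1 k, fun c hc => ?_⟩
    obtain ⟨c, rfl⟩ := H.surjective c
    refine H.mk_le_mk.2 fun n => ?_
    obtain ⟨k, l, hkl⟩ := h2 n
    obtain ⟨m, hm⟩ := H.mk_le_mk.1 (hc ⟨k, rfl⟩) l
    exact ⟨m, H.trans hkl hm⟩

theorem wayBelow_of_rel (H : IsSeqModel r op mk) {x y : RSeq r} {m : ℕ}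
    (h : ∀ n, r (x.1 n) (y.1 m)) : WayBelow (mk x) (mk y) := by
  intro z hz s hs hys
  obtain ⟨s, rfl⟩ := H.surjective s
  choose z' hz' using fun n => H.surjective (z n)
  obtain rfl : (fun n => mk (z' n)) = z := funext hz'
  obtain ⟨l, hl⟩ := H.mk_le_mk.1 hys m
  obtain ⟨k, j, hkj⟩ := ((H.isLUB_iff hz).1 hs).2 l
  exact ⟨k, H.mk_le_mk.2 fun n => ⟨j, H.trans (h n) (H.trans hl hkj)⟩⟩

/-- The sequence `z k` is interpolated between `y k` and `y (k + 2)`. Along even indices the term `y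
(2 * k + 2)` separates consecutive sequences, which makes their classes way below one another. -/
theorem exists_rapid (H : IsSeqModel r op mk) (hi : Interpolates r) (y : RSeq r) :
    ∃ z : ℕ → RSeq r, (∀ k n, r (y.1 k) ((z k).1 n)) ∧ (∀ k n, r ((z k).1 n) (y.1 (k + 2))) ∧
      (∀ k, WayBelow (mk (z (2 * k))) (mk (z (2 * (k + 1))))) ∧
      IsLUB (Set.range fun k => mk (z (2 * k))) (mk y) := by
  choose z h1 h2 using fun k => hi.exists_rseq H.trans (y.2 k) (y.2 (k + 1))
  have h3 (k) : WayBelow (mk (z (2 * k))) (mk (z (2 * (k + 1)))) :=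
    H.wayBelow_of_rel (m := 0) fun n => H.trans (h2 _ n) (h1 (2 * (k + 1)) 0)
  refine ⟨z, h1, h2, h3, ?_⟩
  refine (H.isLUB_iff (monotone_nat_of_le_succ fun k => (h3 k).le)).2
    ⟨fun k => H.mk_le_mk.2 fun n => ⟨_, h2 _ n⟩, fun n => ⟨n, 0, ?_⟩⟩
  rcases Nat.eq_zero_or_pos n with rfl | hn
  · exact h1 _ 0
  · exact H.trans (H.rel_of_lt y (by omega)) (h1 _ 0)

/-- Interpolation enters only from left to right: `mk x` lies below a member of the rapid sequence
for `mk y`, and that member is bounded by a single term of `y`. -/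
theorem wayBelow_iff (H : IsSeqModel r op mk) (hi : Interpolates r) {x y : RSeq r} :
    WayBelow (mk x) (mk y) ↔ ∃ m, ∀ n, r (x.1 n) (y.1 m) := by
  refine ⟨fun h => ?_, fun ⟨m, hm⟩ => H.wayBelow_of_rel hm⟩
  obtain ⟨z, -, h2, h3, h4⟩ := H.exists_rapid hi y
  obtain ⟨k, hk⟩ := h _ (monotone_nat_of_le_succ fun k => (h3 k).le) _ h4 le_rfl
  refine ⟨2 * k + 2, fun n => ?_⟩
  obtain ⟨m, hm⟩ := H.mk_le_mk.1 hk n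
  exact H.trans hm (h2 _ m)

/-- The sequence of the values of `op` on two increasing sequences. -/
def opSeq (H : IsSeqModel r op mk) (x y : RSeq r) : RSeq r :=
  ⟨fun n => op (x.1 n) (y.1 n), fun n => H.op_rel (x.2 n) (y.2 n)⟩

theorem mk_opSeq (H : IsSeqModel r op mk) (x y : RSeq r) :
    mk (H.opSeq x y) = mk x + mk y := H.mk_add _ _ _ fun _ => rfl

theorem add_le_add (H : IsSeqModel r op mk) {a b c d : S} (hab : a ≤ b) (hcd : c ≤ d) :
    a + c ≤ b + d := by
  obtain ⟨a, rfl⟩ := H.surjective a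
  obtain ⟨b, rfl⟩ := H.surjective b
  obtain ⟨c, rfl⟩ := H.surjective c
  obtain ⟨d, rfl⟩ := H.surjective d
  rw [← H.mk_opSeq, ← H.mk_opSeq]
  refine H.mk_le_mk.2 fun n => ?_
  obtain ⟨k, hk⟩ := H.mk_le_mk.1 hab n
  obtain ⟨l, hl⟩ := H.mk_le_mk.1 hcd n
  exact ⟨max k l, H.op_rel (H.rel_mono _ hk (le_max_left _ _))
    (H.rel_mono _ hl (le_max_right _ _))⟩

theorem isCuSemigroup (H : IsSeqModel r op mk) (hi : Interpolates r) : IsCuSemigroup S where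
  add_le_add _ _ _ _ := H.add_le_add
  zero_le a := by
    obtain ⟨a, rfl⟩ := H.surjective a
    rw [← H.mk_zero ⟨fun _ => 0, fun _ => H.zero_rel _⟩ fun _ => rfl]
    exact H.mk_le_mk.2 fun _ => ⟨0, H.zero_rel _⟩
  exists_sup x hx := by
    choose z hz using fun n => H.surjective (x n)
    obtain rfl : (fun n => mk (z n)) = x := funext hz
    obtain ⟨b, hb⟩ := H.exists_diagonal z hx
    exact ⟨mk b, (H.isLUB_iff hx).2 hb⟩
  exists_rapid a := by
    obtain ⟨a, rfl⟩ := H.surjective a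
    obtain ⟨z, -, -, h3, h4⟩ := H.exists_rapid hi a
    exact ⟨_, h3, h4⟩
  wayBelow_add a' a b' b ha hb := by
    obtain ⟨a, rfl⟩ := H.surjective a
    obtain ⟨b, rfl⟩ := H.surjective b
    obtain ⟨a', rfl⟩ := H.surjective a'
    obtain ⟨b', rfl⟩ := H.surjective b'
    obtain ⟨k, hk⟩ := (H.wayBelow_iff hi).1 ha
    obtain ⟨l, hl⟩ := (H.wayBelow_iff hi).1 hb
    rw [← H.mk_opSeq, ← H.mk_opSeq]
    exact H.wayBelow_of_rel (m := max k l) fun n =>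
      H.op_rel (H.rel_mono _ (hk n) (le_max_left _ _)) (H.rel_mono _ (hl n) (le_max_right _ _))
  sup_add x y s t hx hy hs ht := by
    choose x' hx' using fun n => H.surjective (x n)
    choose y' hy' using fun n => H.surjective (y n)
    obtain rfl : (fun n => mk (x' n)) = x := funext hx'
    obtain rfl : (fun n => mk (y' n)) = y := funext hy'
    obtain ⟨s, rfl⟩ := H.surjective s
    obtain ⟨t, rfl⟩ := H.surjective t
    have hm : Monotone fun n => mk (H.opSeq (x' n) (y' n)) := by
      intro m n hmn
      simp only [H.mk_opSeq]
      exact H.add_le_add (hx hmn) (hy hmn)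
    simp only [← H.mk_opSeq]
    refine (H.isLUB_iff hm).2 ⟨fun k => ?_, fun n => ?_⟩
    · rw [H.mk_opSeq, H.mk_opSeq]
      exact H.add_le_add (hs.1 ⟨k, rfl⟩) (ht.1 ⟨k, rfl⟩)
    · obtain ⟨k, i, hi⟩ := ((H.isLUB_iff hx).1 hs).2 n
      obtain ⟨l, j, hj⟩ := ((H.isLUB_iff hy).1 ht).2 n
      obtain ⟨i', hi'⟩ := H.mk_le_mk.1 (hx (le_max_left k l)) i
      obtain ⟨j', hj'⟩ := H.mk_le_mk.1 (hy (le_max_right k l)) j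
      exact ⟨max k l, max i' j', H.op_rel
        (H.rel_mono _ (H.trans hi hi') (le_max_left _ _))
        (H.rel_mono _ (H.trans hj hj') (le_max_right _ _))⟩

end IsSeqModel

/-- `F` is induced by applying `f` termwise to increasing sequences. -/
structure IsSeqMap {A B : Type*} [Zero A] [Zero B] {r : A → A → Prop} {r' : B → B → Prop}
    {S T : Type*} (op : A → A → A) (op' : B → B → B) (mk : RSeq r → S) (mk' : RSeq r' → T)
    (f : A → B) (F : S → T) : Prop where
  map_zero : f 0 = 0
  map_op : ∀ a b, f (op a b) = op' (f a) (f b)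
  map_rel : ∀ {a b}, r a b → r' (f a) (f b)
  map_mk : ∀ (x : RSeq r) (y : RSeq r'), (∀ n, y.1 n = f (x.1 n)) → F (mk x) = mk' y

namespace IsSeqMap

variable {A B : Type*} [Zero A] [Zero B] {r : A → A → Prop} {r' : B → B → Prop}
    {S T : Type*} {op : A → A → A} {op' : B → B → B} {mk : RSeq r → S} {mk' : RSeq r' → T}
    {f : A → B} {F : S → T}

/-- The termwise image of an increasing sequence. -/
def mapSeq (h : IsSeqMap op op' mk mk' f F) (x : RSeq r) : RSeq r' :=
  ⟨fun n => f (x.1 n), fun n => h.map_rel (x.2 n)⟩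

theorem apply_mk (h : IsSeqMap op op' mk mk' f F) (x : RSeq r) :
    F (mk x) = mk' (h.mapSeq x) := h.map_mk _ _ fun _ => rfl

/-- The characterizations of `≪` and of suprema are existential statements about `r`, so a map that
preserves `r` preserves both. Interpolation is needed only in the source. -/
theorem isCuHom [AddCommMonoid S] [PartialOrder S] [AddCommMonoid T] [PartialOrder T]
    (h : IsSeqMap op op' mk mk' f F) (H : IsSeqModel r op mk) (hi : Interpolates r)
    (H' : IsSeqModel r' op' mk') : IsCuHom F := by
  have hmono : Monotone F := by
    intro a b hab
    obtain ⟨a, rfl⟩ := H.surjective a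
    obtain ⟨b, rfl⟩ := H.surjective b
    rw [h.apply_mk, h.apply_mk]
    exact H'.mk_le_mk.2 fun n => (H.mk_le_mk.1 hab n).imp fun _ => h.map_rel
  refine ⟨?_, ?_, hmono, ?_, ?_⟩
  · rw [← H.mk_zero ⟨fun _ => 0, fun _ => H.zero_rel _⟩ fun _ => rfl, h.apply_mk]
    exact H'.mk_zero _ fun _ => h.map_zero
  · intro a b
    obtain ⟨a, rfl⟩ := H.surjective a
    obtain ⟨b, rfl⟩ := H.surjective b
    rw [← H.mk_opSeq, h.apply_mk, h.apply_mk, h.apply_mk]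
    exact H'.mk_add _ _ _ fun n => h.map_op _ _
  · intro a b hab
    obtain ⟨a, rfl⟩ := H.surjective a
    obtain ⟨b, rfl⟩ := H.surjective b
    obtain ⟨m, hm⟩ := (H.wayBelow_iff hi).1 hab
    rw [h.apply_mk, h.apply_mk]
    exact H'.wayBelow_of_rel (m := m) fun n => h.map_rel (hm n)
  · intro x s hx hs
    choose z hz using fun n => H.surjective (x n)
    obtain rfl : (fun n => mk (z n)) = x := funext hz
    obtain ⟨s, rfl⟩ := H.surjective s
    have hm : Monotone fun n => mk' (h.mapSeq (z n)) := by
      simp only [← h.apply_mk]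
      exact hmono.comp hx
    simp only [h.apply_mk]
    obtain ⟨-, h2⟩ := (H.isLUB_iff hx).1 hs
    refine (H'.isLUB_iff hm).2 ⟨fun k => ?_, fun n => ?_⟩
    · rw [← h.apply_mk, ← h.apply_mk]
      exact hmono (hs.1 ⟨k, rfl⟩)
    · obtain ⟨k, l, hkl⟩ := h2 n
      exact ⟨k, l, h.map_rel hkl⟩

end IsSeqMap

/-! ### Direct limits of sets with a relation -/

section Limit

variable {Ω : Type*} [Preorder Ω] {A : Ω → Type*} (φ : ∀ i j, i ≤ j → A i → A j)
    {B : Type*} (ψ : ∀ i, A i → B)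

/-- The cone `(B, ψ)` is the direct limit of the directed system of sets `(A, φ)`, compatibly with
relations. -/
structure IsRelLimit (r : ∀ i, A i → A i → Prop) (r' : B → B → Prop) : Prop where
  map_id : ∀ i a, φ i i le_rfl a = a
  map_comp : ∀ i j k (hij : i ≤ j) (hjk : j ≤ k) a,
    φ j k hjk (φ i j hij a) = φ i k (hij.trans hjk) a
  compat : ∀ i j (h : i ≤ j) a, ψ j (φ i j h a) = ψ i a
  exists_lift : ∀ i b, ∃ (j : Ω) (_ : i ≤ j) (a : A j), ψ j a = b
  map_rel : ∀ i j (h : i ≤ j) a a', r i a a' → r j (φ i j h a) (φ i j h a')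
  proj_rel : ∀ i a a', r i a a' → r' (ψ i a) (ψ i a')
  exists_rel : ∀ i a a', r' (ψ i a) (ψ i a') →
    ∃ (j : Ω) (h : i ≤ j), r j (φ i j h a) (φ i j h a')

variable {φ ψ} {r : ∀ i, A i → A i → Prop} {r' : B → B → Prop}

/-- Two-step chains are lifted because these are the input of `Interpolates`. -/
theorem IsRelLimit.exists_lift_chain [Nonempty Ω] (h : IsRelLimit φ ψ r r') {x y w : B}
    (hxy : r' x y) (hyw : r' y w) : ∃ (i : Ω) (a b c : A i), ψ i a = x ∧ ψ i b = y ∧ ψ i c = w ∧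
      r i a b ∧ r i b c := by
  obtain ⟨i⟩ := ‹Nonempty Ω›
  obtain ⟨i, _, a, rfl⟩ := h.exists_lift i x
  obtain ⟨j, hij, b, rfl⟩ := h.exists_lift i y
  rw [← h.compat i j hij] at hxy
  obtain ⟨k, hjk, hab⟩ := h.exists_rel _ _ _ hxy
  obtain ⟨l, hkl, c, rfl⟩ := h.exists_lift k w
  rw [← h.compat j k hjk, ← h.compat k l hkl] at hyw
  obtain ⟨m, hlm, hbc⟩ := h.exists_rel _ _ _ hyw
  refine ⟨m, _, _, _, ?_, ?_, h.compat l m hlm c, h.map_rel _ _ hlm _ _ (h.map_rel _ _ hkl _ _ hab),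
    hbc⟩ <;> simp only [h.compat]

theorem IsRelLimit.interpolates [Nonempty Ω] [IsDirectedOrder Ω] (h : IsRelLimit φ ψ r r')
    (hi : ∀ i, Interpolates (r i)) : Interpolates r' := by
  intro x y w hxy hyw
  obtain ⟨i, a, b, c, rfl, rfl, rfl, hab, hbc⟩ := h.exists_lift_chain hxy hyw
  obtain ⟨p, q, h1, h2, h3⟩ := hi i _ _ _ hab hbc
  exact ⟨_, _, h.proj_rel _ _ _ h1, h.proj_rel _ _ _ h2, h.proj_rel _ _ _ h3⟩

variable [∀ i, Zero (A i)] [Zero B] {op : ∀ i, A i → A i → A i} {op' : B → B → B}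
    {S : Ω → Type*} [∀ i, AddCommMonoid (S i)] [∀ i, PartialOrder (S i)]
    {L : Type*} [AddCommMonoid L] [PartialOrder L]
    {mk : ∀ i, RSeq (r i) → S i} {mk' : RSeq r' → L}
    {F : ∀ i j, i ≤ j → S i → S j} {G : ∀ i, S i → L}

/-- Both approximation properties need only finitely many relations to be lifted to a stage,
although the elements are infinite sequences: `≪` confines all terms of a sequence below one term.
-/
theorem IsRelLimit.isCuLimitCocone [Nonempty Ω] [IsDirectedOrder Ω] (h : IsRelLimit φ ψ r r')
    (H : ∀ i, IsSeqModel (r i) (op i) (mk i)) (H' : IsSeqModel r' op' mk')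
    (hi : ∀ i, Interpolates (r i))
    (hF : ∀ i j h, IsSeqMap (op i) (op j) (mk i) (mk j) (φ i j h) (F i j h))
    (hG : ∀ i, IsSeqMap (op i) op' (mk i) mk' (ψ i) (G i)) : IsCuLimitCocone S F L G where
  system :=
    { isCu i := (H i).isCuSemigroup (hi i)
      isCuHom i j hij := (hF i j hij).isCuHom (H i) (hi i) (H j)
      map_id i a := by
        obtain ⟨a, rfl⟩ := (H i).surjective a
        exact (hF i i le_rfl).map_mk _ _ fun n => (h.map_id i _).symm
      map_comp i j k hij hjk a := by
        obtain ⟨a, rfl⟩ := (H i).surjective a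
        rw [(hF i j hij).apply_mk, (hF j k hjk).apply_mk]
        exact ((hF i k (hij.trans hjk)).map_mk _ _ fun n => h.map_comp i j k hij hjk _).symm }
  isCu := H'.isCuSemigroup (h.interpolates hi)
  isCuHom i := (hG i).isCuHom (H i) (hi i) H'
  compat i j hij a := by
    obtain ⟨a, rfl⟩ := (H i).surjective a
    rw [(hF i j hij).apply_mk, (hG j).apply_mk]
    exact ((hG i).map_mk _ _ fun n => h.compat i j hij _).symm
  eventually_le i x' x y hx hxy := by
    obtain ⟨x', rfl⟩ := (H i).surjective x'
    obtain ⟨x, rfl⟩ := (H i).surjective x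
    obtain ⟨y, rfl⟩ := (H i).surjective y
    obtain ⟨m, hm⟩ := ((H i).wayBelow_iff (hi i)).1 hx
    rw [(hG i).apply_mk, (hG i).apply_mk] at hxy
    -- All terms of `x'` lie below the `m`-th term of `x`, so lifting this one relation gives the
    -- inequality for the whole sequence.
    obtain ⟨l, hl⟩ := H'.mk_le_mk.1 hxy m
    obtain ⟨j, hij, hj⟩ := h.exists_rel _ _ _ hl
    refine ⟨j, hij, ?_⟩
    rw [(hF i j hij).apply_mk, (hF i j hij).apply_mk]
    exact (H j).mk_le_mk.2 fun n => ⟨l, (H j).trans (h.map_rel _ _ hij _ _ (hm n)) hj⟩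
  exists_between x' x hx := by
    obtain ⟨x', rfl⟩ := H'.surjective x'
    obtain ⟨x, rfl⟩ := H'.surjective x
    obtain ⟨m, hm⟩ := (H'.wayBelow_iff (h.interpolates hi)).1 hx
    -- Three consecutive terms of `x` are lifted to a common stage; a sequence interpolated there
    -- between the outer two represents the required element.
    obtain ⟨i, a, b, c, ha, _, hc, hab, hbc⟩ := h.exists_lift_chain (x.2 m) (x.2 (m + 1))
    obtain ⟨z, hz, hz'⟩ := (hi i).exists_rseq (H i).trans hab hbc
    refine ⟨i, mk i z, ?_, ?_⟩ <;> rw [(hG i).apply_mk]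
    · refine H'.wayBelow_of_rel (m := 0) fun n => H'.trans (hm n) ?_
      rw [← ha]
      exact h.proj_rel _ _ _ (hz 0)
    · refine H'.wayBelow_of_rel (m := m + 1 + 1) fun n => ?_
      rw [← hc]
      exact h.proj_rel _ _ _ (hz' n)

end Limit

end SeqModel

open InfMat

/-! ### Idempotent rings are dense -/

section Idempotent

variable {R : Type*} [NonUnitalRing R]

/-- A sum of two factored matrices factors by placing the factors side by side, `(A A') (B; B')`.
This reduces to one entry that is a product. The inner index type must be free, since it grows with
each sum. -/
theorem IsIdempotentRing.exists_matrix_mul (h : IsIdempotentRing R) {ι κ : Type} [Fintype ι]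
    [Fintype κ] (X : Matrix ι κ R) :
    ∃ (o : Type) (_ : Fintype o) (A : Matrix ι o R) (B : Matrix o κ R), X = A * B := by
  classical
  have h_zero : ∃ (o : Type) (_ : Fintype o) (A : Matrix ι o R) (B : Matrix o κ R), 0 = A * B :=
    ⟨Empty, inferInstance, 0, 0, by simp⟩
  have h_add (p q : Matrix ι κ R)
      (hp : ∃ (o : Type) (_ : Fintype o) (A : Matrix ι o R) (B : Matrix o κ R), p = A * B)
      (hq : ∃ (o : Type) (_ : Fintype o) (A : Matrix ι o R) (B : Matrix o κ R), q = A * B) :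
      ∃ (o : Type) (_ : Fintype o) (A : Matrix ι o R) (B : Matrix o κ R), p + q = A * B := by
    obtain ⟨o, _, A, B, rfl⟩ := hp
    obtain ⟨o', _, A', B', rfl⟩ := hq
    exact ⟨o ⊕ o', inferInstance, Matrix.fromCols A A', Matrix.fromRows B B', by
      ext
      simp [Matrix.mul_apply]⟩
  refine Matrix.induction_on' X h_zero h_add fun i j x => ?_
  have hx : x ∈ AddSubgroup.closure {x : R | ∃ a b : R, x = a * b} := by
    rw [show AddSubgroup.closure {x : R | ∃ a b : R, x = a * b} = ⊤ from h]
    trivial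
  induction hx using AddSubgroup.closure_induction with
  | mem x hx =>
    obtain ⟨a, b, rfl⟩ := hx
    exact ⟨Unit, inferInstance, Matrix.single i () a, Matrix.single () j b, by simp⟩
  | zero => simpa using h_zero
  | add x y _ _ hx hy =>
    rw [Matrix.single_add]
    exact h_add _ _ hx hy
  | neg x _ hx =>
    obtain ⟨o, _, A, B, hAB⟩ := hx
    exact ⟨o, inferInstance, -A, B, by
      rw [Matrix.neg_mul, ← hAB]
      ext a b
      simp only [Matrix.single_apply, Matrix.neg_apply]
      split_ifs <;> simp⟩

theorem IsIdempotentRing.exists_mul (h : IsIdempotentRing R) (x : InfMat R) :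
    ∃ a b : InfMat R, x = a * b := by
  obtain ⟨N, hN⟩ := x.exists_bdd
  obtain ⟨o, _, A, B, hAB⟩ := h.exists_matrix_mul (corner N x)
  have he : Function.Injective fun c => (Fintype.equivFin o c : ℕ) :=
    Fin.val_injective.comp (Fintype.equivFin o).injective
  exact ⟨place Fin.val _ A, place _ Fin.val B, by
    rw [place_mul Fin.val_injective he Fin.val_injective, ← hAB, ← eq_place_corner hN]⟩

theorem IsIdempotentRing.isDenseRing (h : IsIdempotentRing R) : IsDenseRing R := by
  rintro _ y ⟨s, t, rfl⟩
  obtain ⟨s₁, s₂, rfl⟩ := h.exists_mul s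
  obtain ⟨t₁, t₂, rfl⟩ := h.exists_mul t
  exact ⟨s₂ * y * t₁, ⟨s₁, t₂, by simp only [mul_assoc]⟩, s₂, t₁, rfl⟩

end Idempotent

/-! ### `Λ(R)` and `S(R)` as monoids of increasing sequences -/

section Models

variable {R R' : Type*} [NonUnitalRing R] [NonUnitalRing R']

theorem InfMat.map_zero (φ : R →ₙ+* R') : InfMat.map φ 0 = 0 := by
  ext i j
  exact _root_.map_zero φ

theorem InfMat.map_interleave (φ : R →ₙ+* R') (x y : InfMat R) :
    InfMat.map φ (interleave x y) = interleave (InfMat.map φ x) (InfMat.map φ y) := by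
  ext i j
  simp only [InfMat.map, interleave]
  split_ifs <;> simp

theorem interleave_below_interleave {x y x' y' : InfMat R} (h : Below x x') (h' : Below y y') :
    Below (interleave x y) (interleave x' y') := by
  obtain ⟨s, t, rfl⟩ := h
  obtain ⟨s', t', rfl⟩ := h'
  exact ⟨interleave s s', interleave t t', by simp only [interleave_mul]⟩

theorem Lam.mk_add_mk_eq (x y z : IncSeq R) (h : ∀ n, z.1 n = interleave (x.1 n) (y.1 n)) :
    Lam.mk z = Lam.mk x + Lam.mk y :=
  Lam.mk_eq_of_le
    (fun n => ⟨n + 1, by rw [h]; exact interleave_below_oplus (x.2 n) (y.2 n)⟩)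
    (fun n => ⟨n + 1, by rw [h]; exact oplus_below_interleave (x.2 n) (y.2 n)⟩)

/-- Addition is modelled by `interleave` instead of `oplus`: it commutes strictly with entrywise
maps, whereas `oplus` depends on the size of its first argument, which a homomorphism may decrease.
-/
theorem isSeqModel_lam (R : Type*) [NonUnitalRing R] :
    IsSeqModel (Below (A := InfMat R)) interleave (S := Lam R) Lam.mk where
  trans := Below.trans
  zero_rel x := ⟨0, 0, by simp⟩
  op_rel := interleave_below_interleave
  surjective := Quotient.mk_surjective
  mk_le_mk := Iff.rfl
  mk_zero x hx := congrArg Lam.mk (Subtype.ext (funext hx) : x = (0 : IncSeq R))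
  mk_add := Lam.mk_add_mk_eq

theorem IsDenseRing.interpolates (h : IsDenseRing R) : Interpolates (Below (A := InfMat R)) := by
  intro x y w hxy hyw
  obtain ⟨p, hxp, hpw⟩ := h x w (hxy.trans hyw)
  obtain ⟨q, hpq, hqw⟩ := h p w hpw
  exact ⟨p, q, hxp, hpq, hqw⟩

theorem isSeqMap_lam (φ : R →ₙ+* R') :
    IsSeqMap interleave interleave (r := Below) (r' := Below) (S := Lam R) (T := Lam R')
      Lam.mk Lam.mk (InfMat.map φ) (Lam.map φ) where
  map_zero := InfMat.map_zero φ
  map_op := InfMat.map_interleave φ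
  map_rel := map_below φ
  map_mk _ _ h := congrArg Lam.mk (Subtype.ext (funext fun n => (h n).symm))

/-- The relation `x = u y v x` for some `u, v`; its increasing sequences represent the elements of
`S(R)`. -/
def LeftBelow {A : Type*} [Mul A] (x y : A) : Prop := ∃ u v : A, x = u * y * v * x

theorem LeftBelow.below {A : Type*} [Semigroup A] {x y : A} (h : LeftBelow x y) : Below x y := by
  obtain ⟨u, v, h⟩ := h
  exact ⟨u, v * x, by rwa [← mul_assoc]⟩

theorem LeftBelow.trans_below {A : Type*} [Semigroup A] {x y z : A} (h : LeftBelow x y)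
    (h' : Below y z) : LeftBelow x z := by
  obtain ⟨u, v, h⟩ := h
  obtain ⟨s, t, rfl⟩ := h'
  exact ⟨u * s, t * v, by simpa only [mul_assoc] using h⟩

theorem LeftBelow.trans {A : Type*} [Semigroup A] {x y z : A} (h : LeftBelow x y)
    (h' : LeftBelow y z) : LeftBelow x z := h.trans_below h'.below

theorem LeftBelow.map (φ : R →ₙ+* R') {x y : InfMat R} (h : LeftBelow x y) :
    LeftBelow (InfMat.map φ x) (InfMat.map φ y) := by
  obtain ⟨u, v, h⟩ := h
  exact ⟨InfMat.map φ u, InfMat.map φ v, by rw [← InfMat.map_mul, ← InfMat.map_mul, ← InfMat.map_mul, ← h]⟩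

/-- Substitute the identity `xₙ = y xₙ₊₁ xₙ` into itself. -/
theorem IsS.leftBelow {x : IncSeq R} (hx : IsS x) (n : ℕ) : LeftBelow (x.1 n) (x.1 (n + 1)) := by
  obtain ⟨y, hy⟩ := hx n
  refine ⟨y, y * x.1 (n + 1), ?_⟩
  rw [mul_assoc _ (y * _), ← hy, ← hy]

/-- An increasing sequence for `LeftBelow`, regarded as an element of `T(R)`. -/
def incSeqOfLeftBelow (x : RSeq (LeftBelow (A := InfMat R))) : IncSeq R :=
  ⟨x.1, fun n => (x.2 n).below⟩

/-- If `xₙ = uₙ xₙ₊₁ vₙ xₙ`, then `x'ₙ = xₙ₊₁ vₙ` satisfies `x'ₙ = uₙ₊₁ x'ₙ₊₁ x'ₙ`. Thus `x'` lies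
in `𝒮(R)`, and it is equivalent to `x`. -/
theorem mk_incSeqOfLeftBelow_mem (x : RSeq (LeftBelow (A := InfMat R))) :
    Lam.mk (incSeqOfLeftBelow x) ∈ SSub R := by
  choose u v h using x.2
  have key (n) : x.1 n = u n * (x.1 (n + 1) * v n) * x.1 n := by
    rw [← mul_assoc]
    exact h n
  have hS (n) : x.1 (n + 1) * v n = u (n + 1) * (x.1 (n + 1 + 1) * v (n + 1)) *
      (x.1 (n + 1) * v n) := by
    rw [← mul_assoc _ (x.1 (n + 1)), ← key]
  refine ⟨⟨fun n => x.1 (n + 1) * v n, fun n => ⟨_, _, hS n⟩⟩, fun n => ⟨_, hS n⟩,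
    Lam.mk_eq_of_le (fun n => ⟨n + 2, u (n + 1), v (n + 1) * (x.1 (n + 1) * v n), ?_⟩)
      fun n => ⟨n, _, _, key n⟩⟩
  rw [← mul_assoc, mul_assoc _ _ (v (n + 1))]
  exact hS n

/-- The class in `S(R)` of an increasing sequence for `LeftBelow`. -/
def SSub.mk (x : RSeq (LeftBelow (A := InfMat R))) : SSub R :=
  ⟨Lam.mk (incSeqOfLeftBelow x), mk_incSeqOfLeftBelow_mem x⟩

/-- The order on `S(R)` is defined by `≾₁`, but `LeftBelow` induces the same one: passing from `n`
to `n + 1` first supplies a `LeftBelow` step, which absorbs a following `≾₁`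
(`LeftBelow.trans_below`). -/
theorem isSeqModel_ssub (R : Type*) [NonUnitalRing R] :
    IsSeqModel (LeftBelow (A := InfMat R)) interleave (S := SSub R) SSub.mk where
  trans := LeftBelow.trans
  zero_rel x := ⟨0, 0, by simp⟩
  op_rel := by
    rintro x y x' y' ⟨u, v, h⟩ ⟨u', v', h'⟩
    exact ⟨interleave u u', interleave v v', by simp only [interleave_mul]; rw [← h, ← h']⟩
  surjective := by
    rintro ⟨_, x, hx, rfl⟩
    exact ⟨⟨x.1, hx.leftBelow⟩, rfl⟩
  mk_le_mk {x y} := by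
    refine ⟨fun h n => ?_, fun h n => (h n).imp fun _ => LeftBelow.below⟩
    obtain ⟨m, hm⟩ := (Lam.mk_le_mk.1 h : incSeqOfLeftBelow x ≤ incSeqOfLeftBelow y) (n + 1)
    exact ⟨m, (x.2 n).trans_below hm⟩
  mk_zero x hx := Subtype.ext <|
    congrArg Lam.mk (Subtype.ext (funext hx) : incSeqOfLeftBelow x = (0 : IncSeq R))
  mk_add x y z h := Subtype.ext <| Lam.mk_add_mk_eq _ _ (incSeqOfLeftBelow z) h

/-- With `x = u y v x` and `y = u' w v' y`, the elements `a = y v x`, `b = y v u`, `c = u' w v'`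
satisfy `a = b a` and `b = c b`. The resulting `d`, `e` are the intermediate points: `x = u a = u d
(y v) x`, `d = e e e d` and `e = u' w v' e`. -/
theorem IsLeftNormalRing.interpolates (h : IsLeftNormalRing R) :
    Interpolates (LeftBelow (A := InfMat R)) := by
  rintro x y w ⟨u, v, hx⟩ ⟨u', v', hy⟩
  obtain ⟨d, e, h1, h2, h3⟩ := h (y * v * x) (y * v * u) (u' * w * v')
    (by
      simp only [mul_assoc] at hx ⊢
      rw [← hx])
    (by rw [← mul_assoc, ← mul_assoc, ← hy])
  refine ⟨d, e, ⟨u, y * v, ?_⟩, ⟨e, e, ?_⟩, ⟨u', v', h3⟩⟩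
  · rw [mul_assoc, mul_assoc, ← h1]
    simpa only [mul_assoc] using hx
  · rw [mul_assoc, ← h2, mul_assoc, ← h2, ← h2]

theorem isSeqMap_ssub (φ : R →ₙ+* R') :
    IsSeqMap interleave interleave (r := LeftBelow) (r' := LeftBelow) (S := SSub R) (T := SSub R')
      SSub.mk SSub.mk (InfMat.map φ) (SSub.map φ) where
  map_zero := InfMat.map_zero φ
  map_op := InfMat.map_interleave φ
  map_rel := LeftBelow.map φ
  map_mk _ y h := Subtype.ext <|
    congrArg Lam.mk (Subtype.ext (funext fun n => (h n).symm) : _ = incSeqOfLeftBelow y)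

end Models

/-! ### Matrices over a direct limit of rings -/

section DirectLimit

variable {Ω : Type v} [Preorder Ω] {R : Ω → Type u} [∀ i, NonUnitalRing (R i)]
    {φ : ∀ i j : Ω, i ≤ j → (R i →ₙ+* R j)} [DirectedSystem R (fun i j h => φ i j h)]

theorem InfMat.map_map_directed {i j k : Ω} (hij : i ≤ j) (hjk : j ≤ k) (x : InfMat (R i)) :
    InfMat.map (φ j k hjk) (InfMat.map (φ i j hij) x) = InfMat.map (φ i k (hij.trans hjk)) x := by
  ext a b
  exact DirectedSystem.map_map' φ hij hjk _

theorem InfMat.map_id_directed (i : Ω) (x : InfMat (R i)) : InfMat.map (φ i i le_rfl) x = x := by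
  ext a b
  exact DirectedSystem.map_self' φ _

variable [IsDirectedOrder Ω] [Nonempty Ω]

variable (φ) in
/-- The canonical map `M_∞(R i) → M_∞(lim R)`. -/
noncomputable abbrev InfMat.toLimit (i : Ω) : InfMat (R i) → InfMat (DirectLimit R φ) :=
  InfMat.map (DirectLimit.NonUnitalRing.of R φ i)

theorem InfMat.toLimit_map {i j : Ω} (h : i ≤ j) (x : InfMat (R i)) :
    toLimit φ j (InfMat.map (φ i j h) x) = toLimit φ i x := by
  ext a b
  exact DirectLimit.NonUnitalRing.of_f h _

/-- Only finitely many entries need lifting, and directedness supplies a common stage. Placing the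
lifts in an otherwise zero matrix keeps the support finite. -/
theorem InfMat.exists_toLimit_eq (i : Ω) (x : InfMat (DirectLimit R φ)) :
    ∃ (j : Ω) (_ : i ≤ j) (y : InfMat (R j)), toLimit φ j y = x := by
  obtain ⟨N, hN⟩ := x.exists_bdd
  choose k y hy using fun p : Fin N × Fin N => DirectLimit.exists_eq_mk φ (x.entry p.1 p.2)
  obtain ⟨m, hm⟩ := Finite.exists_le k
  obtain ⟨j, hmj, hij⟩ := exists_ge_ge m i
  have hv := Fin.val_injective (n := N)
  refine ⟨j, hij, place Fin.val Fin.val (Matrix.of fun a b =>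
    φ _ j ((hm (a, b)).trans hmj) (y (a, b))), ?_⟩
  rw [eq_place_corner hN]
  refine eq_place hv hv (fun a b => ?_) fun a b hab => ?_
  · simp only [InfMat.map]
    rw [place_apply hv hv, Matrix.of_apply, DirectLimit.NonUnitalRing.of_f]
    exact (hy (a, b)).symm
  · simp only [InfMat.map]
    rw [place_of_notMem _ _ _ hab, _root_.map_zero]

theorem InfMat.exists_map_eq_of_toLimit_eq {i : Ω} {x y : InfMat (R i)}
    (h : toLimit φ i x = toLimit φ i y) :
    ∃ (j : Ω) (hij : i ≤ j), InfMat.map (φ i j hij) x = InfMat.map (φ i j hij) y := by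
  obtain ⟨N, hN⟩ := x.exists_bdd
  obtain ⟨M, hM⟩ := y.exists_bdd
  have key (p : Fin (N + M) × Fin (N + M)) : ∃ (j : Ω) (hij : i ≤ j),
      φ i j hij (x.entry p.1 p.2) = φ i j hij (y.entry p.1 p.2) := by
    obtain ⟨j, h1, _, hj⟩ := Quotient.exact (congrArg (fun z => z.entry p.1 p.2) h)
    exact ⟨j, h1, hj⟩
  choose k hk hxy using key
  obtain ⟨m, hm⟩ := Finite.exists_le k
  obtain ⟨j, hmj, hij⟩ := exists_ge_ge m i
  refine ⟨j, hij, InfMat.ext (funext₂ fun a b => ?_)⟩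
  by_cases hab : a < N + M ∧ b < N + M
  · have h1 := congrArg (φ _ j ((hm (⟨a, hab.1⟩, ⟨b, hab.2⟩)).trans hmj))
      (hxy (⟨a, hab.1⟩, ⟨b, hab.2⟩))
    rwa [DirectedSystem.map_map' φ, DirectedSystem.map_map' φ] at h1
  · simp only [InfMat.map]
    rw [hN a b (by omega), hM a b (by omega)]

/-- The witnesses `s` and `t` are lifted to a stage, where the equation holds after passing to a
further one. -/
theorem Below.exists_of_toLimit {i : Ω} {x y : InfMat (R i)}
    (h : Below (toLimit φ i x) (toLimit φ i y)) :
    ∃ (j : Ω) (hij : i ≤ j), Below (InfMat.map (φ i j hij) x) (InfMat.map (φ i j hij) y) := by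
  obtain ⟨s, t, h⟩ := h
  obtain ⟨j, hij, s, rfl⟩ := exists_toLimit_eq i s
  obtain ⟨k, hjk, t, rfl⟩ := exists_toLimit_eq j t
  rw [← toLimit_map (hij.trans hjk) x, ← toLimit_map (hij.trans hjk) y, ← toLimit_map hjk s,
    ← InfMat.map_mul, ← InfMat.map_mul] at h
  obtain ⟨l, hkl, h⟩ := exists_map_eq_of_toLimit_eq h
  refine ⟨l, (hij.trans hjk).trans hkl, InfMat.map (φ k l hkl) (InfMat.map (φ j k hjk) s),
    InfMat.map (φ k l hkl) t, ?_⟩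
  rwa [InfMat.map_mul, InfMat.map_mul, map_map_directed (hij.trans hjk), map_map_directed (hij.trans hjk)] at h

theorem LeftBelow.exists_of_toLimit {i : Ω} {x y : InfMat (R i)}
    (h : LeftBelow (toLimit φ i x) (toLimit φ i y)) :
    ∃ (j : Ω) (hij : i ≤ j), LeftBelow (InfMat.map (φ i j hij) x) (InfMat.map (φ i j hij) y) := by
  obtain ⟨s, t, h⟩ := h
  obtain ⟨j, hij, s, rfl⟩ := exists_toLimit_eq i s
  obtain ⟨k, hjk, t, rfl⟩ := exists_toLimit_eq j t
  rw [← toLimit_map (hij.trans hjk) x, ← toLimit_map (hij.trans hjk) y, ← toLimit_map hjk s,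
    ← InfMat.map_mul, ← InfMat.map_mul, ← InfMat.map_mul] at h
  obtain ⟨l, hkl, h⟩ := exists_map_eq_of_toLimit_eq h
  refine ⟨l, (hij.trans hjk).trans hkl, InfMat.map (φ k l hkl) (InfMat.map (φ j k hjk) s),
    InfMat.map (φ k l hkl) t, ?_⟩
  rwa [InfMat.map_mul, InfMat.map_mul, InfMat.map_mul, map_map_directed (hij.trans hjk),
    map_map_directed (hij.trans hjk)] at h

theorem isRelLimit_below : IsRelLimit (fun i j h => InfMat.map (φ i j h)) (toLimit φ)
    (fun _ => Below) Below where
  map_id := map_id_directed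
  map_comp _ _ _ := map_map_directed
  compat _ _ := toLimit_map
  exists_lift := exists_toLimit_eq
  map_rel _ _ _ _ _ := map_below _
  proj_rel _ _ _ := map_below _
  exists_rel _ _ _ := Below.exists_of_toLimit

theorem isRelLimit_leftBelow : IsRelLimit (fun i j h => InfMat.map (φ i j h)) (toLimit φ)
    (fun _ => LeftBelow) LeftBelow where
  map_id := map_id_directed
  map_comp _ _ _ := map_map_directed
  compat _ _ := toLimit_map
  exists_lift := exists_toLimit_eq
  map_rel _ _ _ _ _ := LeftBelow.map _
  proj_rel _ _ _ := LeftBelow.map _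
  exists_rel _ _ _ := LeftBelow.exists_of_toLimit

theorem IsDenseRing.directLimit (h : ∀ i, IsDenseRing (R i)) : IsDenseRing (DirectLimit R φ) := by
  intro x y hxy
  obtain ⟨i, _, x, rfl⟩ := exists_toLimit_eq (Classical.arbitrary Ω) x
  obtain ⟨j, hij, y, rfl⟩ := exists_toLimit_eq i y
  rw [← toLimit_map hij] at hxy ⊢
  obtain ⟨k, hjk, hxy⟩ := hxy.exists_of_toLimit
  obtain ⟨z, h1, h2⟩ := h k _ _ hxy
  rw [← toLimit_map hjk, ← toLimit_map hjk y]
  exact ⟨toLimit φ k z, map_below _ h1, map_below _ h2⟩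

/-- The three matrices and the two equations hold at a common stage; the `d` and `e` found there map
to the limit. -/
theorem IsLeftNormalRing.directLimit (h : ∀ i, IsLeftNormalRing (R i)) :
    IsLeftNormalRing (DirectLimit R φ) := by
  intro a b c hab hbc
  obtain ⟨i, _, a, rfl⟩ := exists_toLimit_eq (Classical.arbitrary Ω) a
  obtain ⟨j, hij, b, rfl⟩ := exists_toLimit_eq i b
  rw [← toLimit_map hij a, ← InfMat.map_mul] at hab
  obtain ⟨k, hjk, hab⟩ := exists_map_eq_of_toLimit_eq hab
  obtain ⟨l, hkl, c, rfl⟩ := exists_toLimit_eq k c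
  rw [← toLimit_map (hjk.trans hkl) b, ← InfMat.map_mul] at hbc
  obtain ⟨m, hlm, hbc⟩ := exists_map_eq_of_toLimit_eq hbc
  have hkm := hkl.trans hlm
  replace hab := congrArg (InfMat.map (φ k m hkm)) hab
  simp only [InfMat.map_mul, map_map_directed] at hab hbc
  obtain ⟨d, e, h1, h2, h3⟩ := h m _ _ _ hab hbc
  rw [← toLimit_map ((hij.trans hjk).trans hkm), ← toLimit_map hlm c]
  refine ⟨toLimit φ m d, toLimit φ m e, ?_, ?_, ?_⟩ <;> rw [← InfMat.map_mul]
  exacts [congrArg _ h1, congrArg _ h2, congrArg _ h3]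

theorem isCuLimitCocone_lam (h : ∀ i, IsDenseRing (R i)) :
    IsCuLimitCocone (fun i => Lam (R i)) (fun i j h => Lam.map (φ i j h)) (Lam (DirectLimit R φ))
      (fun i => Lam.map (DirectLimit.NonUnitalRing.of R φ i)) :=
  isRelLimit_below.isCuLimitCocone (fun i => isSeqModel_lam (R i)) (isSeqModel_lam _)
    (fun i => (h i).interpolates) (fun _ _ _ => isSeqMap_lam _) (fun _ => isSeqMap_lam _)

theorem isCuLimitCocone_ssub (h : ∀ i, IsLeftNormalRing (R i)) :
    IsCuLimitCocone (fun i => SSub (R i)) (fun i j h => SSub.map (φ i j h))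
      (SSub (DirectLimit R φ)) (fun i => SSub.map (DirectLimit.NonUnitalRing.of R φ i)) :=
  isRelLimit_leftBelow.isCuLimitCocone (fun i => isSeqModel_ssub (R i)) (isSeqModel_ssub _)
    (fun i => (h i).interpolates) (fun _ _ _ => isSeqMap_ssub _) (fun _ => isSeqMap_ssub _)

end DirectLimit

end CuntzRing


theorem mainTheorem5 {Ω : Type v} [Preorder Ω] [IsDirectedOrder Ω] [Nonempty Ω]
    (R : Ω → Type u) [∀ i, NonUnitalRing (R i)]
    (φ : ∀ i j : Ω, i ≤ j → (R i →ₙ+* R j))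
    [DirectedSystem R (fun i j h => φ i j h)] :
    ((∀ i, CuntzRing.IsIdempotentRing (R i)) → ∀ i, CuntzRing.IsDenseRing (R i)) ∧
    ((∀ i, CuntzRing.IsDenseRing (R i)) →
      CuntzRing.IsDenseRing (DirectLimit R φ) ∧
      CuntzRing.IsCuDirectSystem (fun i => CuntzRing.Lam (R i))
        (fun i j h => CuntzRing.Lam.map (φ i j h)) ∧
      CuntzRing.IsCuLimit.{w} (fun i => CuntzRing.Lam (R i))
        (fun i j h => CuntzRing.Lam.map (φ i j h))
        (CuntzRing.Lam (DirectLimit R φ))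
        (fun i => CuntzRing.Lam.map (DirectLimit.NonUnitalRing.of R φ i))) ∧
    ((∀ i, CuntzRing.IsLeftNormalRing (R i)) →
      CuntzRing.IsLeftNormalRing (DirectLimit R φ) ∧
      CuntzRing.IsCuDirectSystem (fun i => CuntzRing.SSub (R i))
        (fun i j h => CuntzRing.SSub.map (φ i j h)) ∧
      CuntzRing.IsCuLimit.{w} (fun i => CuntzRing.SSub (R i))
        (fun i j h => CuntzRing.SSub.map (φ i j h))
        (CuntzRing.SSub (DirectLimit R φ))
        (fun i => CuntzRing.SSub.map (DirectLimit.NonUnitalRing.of R φ i))) := by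
  exact ⟨fun h i => (h i).isDenseRing,
    fun h => ⟨.directLimit h, (CuntzRing.isCuLimitCocone_lam h).system,
      (CuntzRing.isCuLimitCocone_lam h).isCuLimit⟩,
    fun h => ⟨.directLimit h, (CuntzRing.isCuLimitCocone_ssub h).system,
      (CuntzRing.isCuLimitCocone_ssub h).isCuLimit⟩⟩
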